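/- Let $d\ge 2$ and $\vartheta>d+1$. For $\theta\ge0$ let $L^\infty_\theta$ be the space of measurable vector fields $f$ on $\mathbb R^d$ with $\|f\|_{L^\infty_\theta}=\operatorname{ess\,sup}_x(1+|x|)^\theta|f(x)|<\infty$. Let $a\in L^\infty_\vartheta$ be a vector field on $\mathbb R^d$ that is divergence-free in the sense of distributions, and let $u$ be a global mild solution of the incompressible Navier–Stokes equations with initial datum $a$. This means that $u(t)\in L^\infty$ for every $t\ge0$; that $t\mapsto u(t)$ is continuous in the $L^\infty$ norm at every $t>0$; that $u(0)=a$ and $u(t)\to a$ in the sense of distributions as $t\downarrow0$; and that for every $t>0$ $$u(t)=e^{t\Delta}a-\int_0^t e^{(t-s)\Delta}\,\mathbb P\,\mathrm{div}(u\otimes u)(s)\,ds ,$$ where $e^{t\Delta}a$ is the convolution of $a$ with the Gaussian $(4\pi t)^{-d/2}e^{-|x|^2/4t}$, $\mathbb P$ is the Leray–Hopf projector, and $e^{t\Delta}\mathbb P\,\mathrm{div}$ is the convolution operator with kernel $$F_{j;h,k}(x,t)=\int_{\mathbb R^d} i\,e^{-t|\xi|^2+ix\cdot\xi}\Bigl(\tfrac12[\xi_h\delta_{j,k}+\xi_k\delta_{j,h}]-\frac{\xi_j\xi_h\xi_k}{|\xi|^2}\Bigr)\frac{d\xi}{(2\pi)^d}.$$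 Assume that there is a constant $C_0$ such that, for all $\alpha,\beta\ge0$ with $\alpha+\beta\le\min\{\vartheta,d+1\}=d+1$, $$|u(x,t)|\le C_0(1+|x|)^{-\alpha}(1+t)^{-\beta/2}\qquad(x\in\mathbb R^d,\ t\ge0).$$ For $x\neq0$ put $$\Pi(x,t)=\gamma_d\sum_{h,k=1}^d\Bigl(\frac{\delta_{h,k}}{d|x|^d}-\frac{x_hx_k}{|x|^{d+2}}\Bigr)\int_0^t\!\int_{\mathbb R^d}(u_hu_k)(y,s)\,dy\,ds,\qquad \gamma_d=\pi^{-d/2}\,\Gamma\bigl(\tfrac{d+2}{2}\bigr).$$ Then for every $x\ne0$ the limit $\nabla\Pi_\infty(x)=\lim_{t\to\infty}\nabla\Pi(x,t)$ exists. If $\nabla\Pi_\infty\not\equiv0$ on $\mathbb R^d\setminus\{0\}$, then there exist $t_0>0$ and $c>0$, independent of $p$, $\alpha$ and $t$, such that: 1. for all $1\le p<\infty$ and $\alpha\ge0$ with $\alpha+\frac dp<d+1$, and all $t\ge t_0$, $$\bigl\|(1+|x|)^\alpha u(t)\bigr\|_{L^p}\ge c\,t^{-\frac12\left(d+1-\alpha-\frac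 dp\right)};$$ 2. for all $0\le\alpha\le d+1$ and all $t\ge t_0$, $$\|u(t)\|_{L^\infty_\alpha}\ge c\,t^{-\frac12(d+1-\alpha)}.$$ -/

import Mathlib

open MeasureTheory Filter Topology
open scoped ENNReal

namespace NavierStokes

/-- The Euclidean space `ℝ^d`. -/
abbrev Sp (d : ℕ) : Type := EuclideanSpace ℝ (Fin d)

/-- The weighted norm `‖(1+|x|)^α f‖_{L^p}` of a vector field, as an extended nonnegative number;
for `p = ∞` it is the norm of the space `L^∞_α`. -/
noncomputable def wNorm {d : ℕ} (p : ℝ≥0∞) (α : ℝ) (f : Sp d → Sp d) : ℝ≥0∞ :=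
  eLpNorm (fun x => (1 + ‖x‖) ^ α • f x) p volume

/-- The space `L^∞_θ` of measurable vector fields with finite weighted sup norm. -/
def MemLinf {d : ℕ} (θ : ℝ) (f : Sp d → Sp d) : Prop :=
  AEStronglyMeasurable f volume ∧ wNorm ⊤ θ f < ⊤

/-- Real-valued test functions on `ℝ^d`. -/
def IsTest {d : ℕ} (φ : Sp d → ℝ) : Prop :=
  ContDiff ℝ ((⊤ : ℕ∞) : WithTop ℕ∞) φ ∧ HasCompactSupport φ

/-- `div a = 0` in the sense of distributions. -/
def DivFree {d : ℕ} (a : Sp d → Sp d) : Prop :=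
  ∀ φ : Sp d → ℝ, IsTest φ → ∫ x, inner ℝ (a x) (gradient φ x) = 0

/-- The class `C_w([0,∞); L^∞_θ)`: strong continuity at positive times, and continuity
at time `0` in the sense of distributions. -/
structure MemCw {d : ℕ} (θ : ℝ) (u : ℝ → Sp d → Sp d) : Prop where
  mem : ∀ t, 0 ≤ t → MemLinf θ (u t)
  cont : ∀ t, 0 < t → Tendsto (fun t' => wNorm ⊤ θ (u t' - u t)) (𝓝 t) (𝓝 0)
  weak : ∀ φ : Sp d → ℝ, IsTest φ →
    Tendsto (fun t => ∫ x, φ x • u t x) (𝓝[>] 0) (𝓝 (∫ x, φ x • u 0 x))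

/-- The heat evolution `e^{tΔ} a`, for `t > 0`. -/
noncomputable def heat {d : ℕ} (a : Sp d → Sp d) (t : ℝ) (x : Sp d) : Sp d :=
  (4 * Real.pi * t) ^ (-(d : ℝ) / 2) • ∫ y, Real.exp (-‖x - y‖ ^ 2 / (4 * t)) • a y

/-- Kronecker symbol. -/
def kron {d : ℕ} (i j : Fin d) : ℝ := if i = j then 1 else 0

/-- The kernel `F_{j;h,k}(x,t)` of the convolution operator `e^{tΔ} ℙ div`, `t > 0`, where `ℙ` is
the Leray-Hopf projector, as an inverse Fourier integral:
`∫ i e^{-t|ξ|² + i x·ξ} ((ξ_h δ_{jk} + ξ_k δ_{jh})/2 - ξ_j ξ_h ξ_k/|ξ|²) dξ/(2π)^d`.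
The integral is a real number. -/
noncomputable def kernelF {d : ℕ} (j h k : Fin d) (t : ℝ) (x : Sp d) : ℝ :=
  (((2 * Real.pi : ℝ) ^ d : ℂ)⁻¹ *
    ∫ ξ : Sp d, Complex.I *
      Complex.exp (-((t * ‖ξ‖ ^ 2 : ℝ) : ℂ) + Complex.I * ((inner ℝ x ξ : ℝ) : ℂ)) *
      (((ξ h * kron j k + ξ k * kron j h) / 2 - ξ j * ξ h * ξ k / ‖ξ‖ ^ 2 : ℝ) : ℂ)).re

/-- `u` is a global mild solution of the Navier-Stokes equations with initial datum `a`: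
it belongs to `C_w([0,∞); L^∞)`, starts from `a`, and satisfies
`u(t) = e^{tΔ}a - ∫_0^t e^{(t-s)Δ} ℙ div (u ⊗ u)(s) ds` for all `t > 0`. -/
structure IsMildSolution {d : ℕ} (a : Sp d → Sp d) (u : ℝ → Sp d → Sp d) : Prop where
  memCw : MemCw 0 u
  initial : u 0 =ᵐ[volume] a
  duhamel : ∀ t, 0 < t → ∀ᵐ x, ∀ j : Fin d,
    u t x j = heat a t x j -
      ∑ h : Fin d, ∑ k : Fin d,
        ∫ s in (0 : ℝ)..t, ∫ y, kernelF j h k (t - s) (x - y) * (u s y h * u s y k)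

/-- The time integrated energy matrix `K_{h,k}(t) = ∫_0^t ∫ u_h u_k dy ds`. -/
noncomputable def energyK {d : ℕ} (u : ℝ → Sp d → Sp d) (h k : Fin d) (t : ℝ) : ℝ :=
  ∫ s in (0 : ℝ)..t, ∫ y, u s y h * u s y k

/-- The constant `γ_d = π^{-d/2} Γ((d+2)/2)`. -/
noncomputable def gammaD (d : ℕ) : ℝ :=
  Real.pi ^ (-(d : ℝ) / 2) * Real.Gamma (((d : ℝ) + 2) / 2)

/-- The potential `Π(x,t)`, for `x ≠ 0`. -/
noncomputable def potential {d : ℕ} (u : ℝ → Sp d → Sp d) (t : ℝ) (x : Sp d) : ℝ :=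
  gammaD d * ∑ h : Fin d, ∑ k : Fin d,
    (kron h k / ((d : ℝ) * ‖x‖ ^ d) - x h * x k / ‖x‖ ^ (d + 2)) * energyK u h k t

/-- `∇Π_∞(x) = lim_{t → ∞} ∇Π(x,t)`, for `x ≠ 0`. -/
noncomputable def gradPotentialInfty {d : ℕ} (u : ℝ → Sp d → Sp d) (x : Sp d) : Sp d :=
  limUnder atTop (fun t : ℝ => gradient (potential u t) x)

/-- The space-time decay
`|u(x,t)| ≤ C₀ (1+|x|)^{-α} (1+t)^{-β/2}` for all `α, β ≥ 0` with `α + β ≤ min (ϑ, d+1)`. -/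
def SpaceTimeDecay {d : ℕ} (ϑ : ℝ) (u : ℝ → Sp d → Sp d) : Prop :=
  ∃ C₀ : ℝ, ∀ α β : ℝ, 0 ≤ α → 0 ≤ β → α + β ≤ min ϑ ((d : ℝ) + 1) →
    ∀ t : ℝ, 0 ≤ t → ∀ᵐ x : Sp d, ‖u t x‖ ≤ C₀ * (1 + ‖x‖) ^ (-α) * (1 + t) ^ (-β / 2)

end NavierStokes

/-!
The proof looks at the solution in parabolic units and shows that
`t^{(d+1)/2} u(√t x, t) → U(x)` for every `x`, where the profile `U` (`profile`) is, up to a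
constant, the inverse Fourier transform of
`-i e^{-|ξ|²} (∑_{h,k} K_{hk} σ_{j;hk}(ξ) + ∑_k m_{kj} ξ_k)`, with `σ` the symbol of `ℙ div`,
`m_{kj} = ∫ y_k a_j` and `K = lim energyK`.

* The heat flow contributes the moments `m`, because a divergence-free integrable field has mean
  zero (`DivFree.integral_eq_zero`, `tendsto_heat`).
* The nonlinearity contributes `K` (`tendsto_duhamel`). The decay of `u` makes `u_h u_k` integrable in
  space-time, so for `s ≤ t/2` dominated convergence applies, with the self-similarity of the kernel.
  For `s ≥ t/2` one uses the `L¹` norm of the kernel, a multiple of `(t-s)^{-1/2}`. The kernel is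
  integrable because `|ξ|⁻² e^{-|ξ|²} = ∫₁^∞ e^{-s|ξ|²} ds` writes its nonlocal part as a superposition
  of third derivatives of Gaussians (`oscInt_cubic_div_eq`, `exists_kernelF_one_le`).

If `U` vanishes identically, then by Fourier inversion its symbol vanishes, which says that
`|ξ|² ((K + mᵀ) ξ)_j = ξ_j (ξ · K ξ)`. So every vector is an eigenvector of `K + mᵀ`, and `K` is a multiple
of the identity (`eq_smul_kron_of_profileSymb_eq_zero`). But the potential attached to the
identity matrix is zero, so that `∇Π_∞ = 0`. Hence, if `∇Π_∞` is not zero, `U` does not vanish on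
some ball `B` away from the origin, and since `t^{(d+1)/2} u(√t x, t)` is bounded, its norm
in `L¹(B)` stays bounded below (`exists_ball_lower_bound`). Hölder's inequality on the balls
`√t B`, where `|x|` is comparable to `√t`, turns this into all the weighted lower bounds at once, with
one constant (`wNorm_lower_bound`).
-/

namespace NavierStokes

/-! ### Oscillatory integrals -/

/-- The oscillatory integral `∫ f(ξ) e^{i x·ξ} dξ` of a real amplitude, which is the inverse Fourier
transform of `f` without its normalizing constant. -/
noncomputable def oscInt {d : ℕ} (f : Sp d → ℝ) (x : Sp d) : ℂ :=
  ∫ ξ, (f ξ : ℂ) * Complex.exp (Complex.I * ((inner ℝ x ξ : ℝ) : ℂ))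

lemma norm_exp_I_mul (r : ℝ) : ‖Complex.exp (Complex.I * (r : ℂ))‖ = 1 := by
  rw [mul_comm, Complex.norm_exp_ofReal_mul_I]

lemma continuous_oscFactor {d : ℕ} (x : Sp d) :
    Continuous fun ξ : Sp d => Complex.exp (Complex.I * ((inner ℝ x ξ : ℝ) : ℂ)) := by
  fun_prop

lemma integrable_oscInt {d : ℕ} {f : Sp d → ℝ} (hf : Integrable f) (x : Sp d) :
    Integrable fun ξ : Sp d =>
      (f ξ : ℂ) * Complex.exp (Complex.I * ((inner ℝ x ξ : ℝ) : ℂ)) := by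
  refine hf.ofReal.mul_bdd (c := 1) (continuous_oscFactor x).aestronglyMeasurable ?_
  exact ae_of_all _ fun ξ => (norm_exp_I_mul _).le

lemma continuous_oscInt {d : ℕ} {f : Sp d → ℝ} (hf : Integrable f) : Continuous (oscInt f) := by
  refine continuous_of_dominated (bound := fun ξ => |f ξ|)
    (fun x => (integrable_oscInt hf x).aestronglyMeasurable) ?_ hf.norm ?_
  · exact fun x => ae_of_all _ fun ξ => by simp
  · exact ae_of_all _ fun ξ => by fun_prop

lemma oscInt_add {d : ℕ} {f g : Sp d → ℝ} (hf : Integrable f) (hg : Integrable g) (x : Sp d) :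
    oscInt (fun ξ => f ξ + g ξ) x = oscInt f x + oscInt g x := by
  unfold oscInt
  rw [← integral_add (integrable_oscInt hf x) (integrable_oscInt hg x)]
  congr 1; ext ξ; push_cast; ring

lemma oscInt_const_mul {d : ℕ} (c : ℝ) (f : Sp d → ℝ) (x : Sp d) :
    oscInt (fun ξ => c * f ξ) x = c * oscInt f x := by
  unfold oscInt
  rw [← integral_const_mul]
  congr 1; ext ξ; push_cast; ring

lemma oscInt_sum {d : ℕ} {ι : Type*} (s : Finset ι) {f : ι → Sp d → ℝ}
    (hf : ∀ i ∈ s, Integrable (f i)) (x : Sp d) :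
    oscInt (fun ξ => ∑ i ∈ s, f i ξ) x = ∑ i ∈ s, oscInt (f i) x := by
  unfold oscInt
  rw [← integral_finsetSum _ fun i hi => integrable_oscInt (hf i hi) x]
  congr 1; ext ξ; push_cast; rw [Finset.sum_mul]

/-- The dilation rule of the Fourier transform. -/
lemma oscInt_comp_smul {d : ℕ} (f : Sp d → ℝ) {c : ℝ} (hc : 0 < c) (x : Sp d) :
    oscInt (fun ξ => f (c • ξ)) x = ((c ^ d)⁻¹ : ℝ) * oscInt f (c⁻¹ • x) := by
  unfold oscInt
  have := Measure.integral_comp_smul (volume : Measure (Sp d)) (fun ξ : Sp d =>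
    (f ξ : ℂ) * Complex.exp (Complex.I * ((inner ℝ (c⁻¹ • x) ξ : ℝ) : ℂ))) c
  rw [finrank_euclideanSpace_fin, abs_of_pos (by positivity), Complex.real_smul] at this
  rw [← this]
  congr 1; ext ξ
  rw [real_inner_smul_left, real_inner_smul_right, inv_mul_cancel_left₀ hc.ne']

/-- `I * oscInt f` is real for an odd amplitude `f`. -/
lemma oscInt_odd_real {d : ℕ} {f : Sp d → ℝ} (hf : ∀ ξ, f (-ξ) = -f ξ) (x : Sp d) :
    (((Complex.I * oscInt f x).re : ℝ) : ℂ) = Complex.I * oscInt f x := by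
  rw [← Complex.conj_eq_iff_re, map_mul, Complex.conj_I]
  have : (starRingEnd ℂ) (oscInt f x) = - oscInt f x := by
    unfold oscInt
    rw [← integral_conj, ← integral_neg_eq_self, ← integral_neg]
    congr 1; ext ξ
    rw [map_mul, Complex.conj_ofReal, ← Complex.exp_conj, map_mul, Complex.conj_I,
      Complex.conj_ofReal, hf, inner_neg_right]
    push_cast
    ring_nf
  rw [this]; ring

/-- Injectivity of the Fourier transform on integrable functions, at a point of continuity. -/
lemma eq_zero_of_oscInt_eq_zero {d : ℕ} {f : Sp d → ℝ} (hf : Integrable f)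
    (h0 : ∀ x, oscInt f x = 0) {ξ : Sp d} (hc : ContinuousAt f ξ) : f ξ = 0 := by
  have hF : FourierTransform.fourier (fun ξ => (f ξ : ℂ)) = 0 := by
    ext w
    rw [Real.fourier_eq', Pi.zero_apply, ← h0 (-(2 * Real.pi) • w)]
    unfold oscInt
    congr 1; ext v
    rw [smul_eq_mul, mul_comm, real_inner_smul_left, real_inner_comm]
    congr 2
    push_cast; ring
  have hf' : Integrable fun ξ => (f ξ : ℂ) := hf.ofReal
  have := hf'.fourierInv_fourier_eq (v := ξ) (by rw [hF]; exact integrable_zero _ _ _)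
    (Complex.continuous_ofReal.continuousAt.comp hc)
  rw [hF, Real.fourierInv_eq'] at this
  simpa using this.symm

lemma inner_single_right' {d : ℕ} (j : Fin d) (ξ : Sp d) :
    (inner ℝ (EuclideanSpace.single j (1 : ℝ)) ξ : ℝ) = ξ j := by
  simp [EuclideanSpace.inner_single_left]

/-- Differentiating an oscillatory integral in direction `e_j` multiplies its amplitude
by `i ξ_j`. -/
lemma hasDerivAt_oscInt {d : ℕ} {f : Sp d → ℝ} (hf : Integrable f) (j : Fin d)
    (hf' : Integrable fun ξ : Sp d => ξ j * f ξ) (x : Sp d) :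
    HasDerivAt (fun r : ℝ => oscInt f (x + r • EuclideanSpace.single j (1 : ℝ)))
      (Complex.I * oscInt (fun ξ => ξ j * f ξ) x) 0 := by
  have key := hasDerivAt_integral_of_dominated_loc_of_deriv_le (μ := (volume : Measure (Sp d)))
    (s := Set.univ) (x₀ := (0 : ℝ)) (bound := fun ξ : Sp d => |ξ j * f ξ|)
    (F := fun (r : ℝ) (ξ : Sp d) => (f ξ : ℂ) * Complex.exp (Complex.I *
      ((inner ℝ (x + r • EuclideanSpace.single j (1 : ℝ)) ξ : ℝ) : ℂ)))
    (F' := fun (r : ℝ) (ξ : Sp d) => Complex.I * (((ξ j * f ξ : ℝ) : ℂ) * Complex.exp (Complex.I *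
      ((inner ℝ (x + r • EuclideanSpace.single j (1 : ℝ)) ξ : ℝ) : ℂ))))
    univ_mem (Eventually.of_forall fun r => (integrable_oscInt hf _).aestronglyMeasurable)
    (integrable_oscInt hf _) ((integrable_oscInt hf' _).const_mul _).aestronglyMeasurable
    (ae_of_all _ fun ξ r _ => by simp) hf'.norm
    (ae_of_all _ fun ξ r _ => by
      have h1 : HasDerivAt (fun r : ℝ => Complex.I *
          ((inner ℝ (x + r • EuclideanSpace.single j (1 : ℝ)) ξ : ℝ) : ℂ))
          (Complex.I * (ξ j : ℂ)) r := by
        refine HasDerivAt.const_mul _ (HasDerivAt.ofReal_comp (f := fun r : ℝ =>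
          (inner ℝ (x + r • EuclideanSpace.single j (1 : ℝ)) ξ : ℝ)) ?_)
        simp only [inner_add_left, real_inner_smul_left, inner_single_right']
        simpa using ((hasDerivAt_id r).mul_const (ξ j)).const_add (inner ℝ x ξ)
      refine (h1.cexp.const_mul (f ξ : ℂ)).congr_deriv ?_
      push_cast; ring)
  refine key.2.congr_deriv ?_
  simp only [zero_smul, add_zero]
  rw [integral_const_mul]; rfl

/-! ### Gaussian moments -/

/-- Polynomial growth is absorbed by the Gaussian. -/
lemma one_add_pow_mul_exp_le (m : ℕ) {r : ℝ} (hr : 0 ≤ r) :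
    (1 + r) ^ m * Real.exp (-r ^ 2 / 4) ≤ m.factorial * Real.exp 2 := by
  have h1 : (1 + r) ^ m ≤ m.factorial * Real.exp (1 + r) := by
    have := Real.pow_div_factorial_le_exp (1 + r) (by linarith) m
    rwa [div_le_iff₀' (by positivity)] at this
  have h2 : Real.exp (-r ^ 2 / 4) ≤ Real.exp (1 - r) :=
    Real.exp_le_exp.2 (by nlinarith [sq_nonneg (r / 2 - 1)])
  calc _ ≤ (m.factorial * Real.exp (1 + r)) * Real.exp (1 - r) := by gcongr
    _ = m.factorial * Real.exp 2 := by rw [mul_assoc, ← Real.exp_add]; norm_num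

lemma integrable_of_gaussian_bound {d : ℕ} {f : Sp d → ℝ} (hf : AEStronglyMeasurable f volume)
    (C : ℝ) (m : ℕ) (hb : ∀ ξ, |f ξ| ≤ C * ((1 + ‖ξ‖) ^ m * Real.exp (-‖ξ‖ ^ 2 / 4))) :
    Integrable f := by
  have hC : 0 ≤ C := by
    have := (abs_nonneg _).trans (hb 0)
    simpa using this
  have hi : Integrable fun ξ : Sp d => (1 + ‖ξ‖) ^ (-((d : ℝ) + 1)) :=
    integrable_one_add_norm (by rw [finrank_euclideanSpace_fin]; linarith)
  refine (hi.const_mul (C * ((m + (d + 1)).factorial * Real.exp 2))).mono' hf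
    (ae_of_all _ fun ξ => ?_)
  have h1 : 0 < 1 + ‖ξ‖ := by positivity
  have h2 := one_add_pow_mul_exp_le (m + (d + 1)) (norm_nonneg ξ)
  rw [Real.norm_eq_abs]
  refine (hb ξ).trans ?_
  rw [Real.rpow_neg h1.le, show ((d : ℝ) + 1) = ((d + 1 : ℕ) : ℝ) by push_cast; rfl,
    Real.rpow_natCast, mul_assoc]
  refine mul_le_mul_of_nonneg_left ?_ hC
  rw [← div_eq_mul_inv, le_div_iff₀ (by positivity)]
  refine le_trans (le_of_eq ?_) h2
  rw [pow_add]; ring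

lemma exp_neg_sq_le {r : ℝ} : Real.exp (-r ^ 2) ≤ Real.exp (-r ^ 2 / 4) :=
  Real.exp_le_exp.2 (by nlinarith [sq_nonneg r])

lemma abs_coord_le {d : ℕ} (ξ : Sp d) (j : Fin d) : |ξ j| ≤ ‖ξ‖ := PiLp.norm_apply_le ξ j

lemma integrable_gauss {d : ℕ} : Integrable fun ξ : Sp d => Real.exp (-‖ξ‖ ^ 2) :=
  integrable_of_gaussian_bound (by fun_prop) 1 0 fun ξ => by
    simpa [abs_of_pos (Real.exp_pos _)] using exp_neg_sq_le

lemma integrable_gauss₁ {d : ℕ} (j : Fin d) :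
    Integrable fun ξ : Sp d => ξ j * Real.exp (-‖ξ‖ ^ 2) :=
  integrable_of_gaussian_bound (by fun_prop) 1 1 fun ξ => by
    rw [abs_mul, abs_of_pos (Real.exp_pos _), one_mul]
    have := abs_coord_le ξ j
    exact mul_le_mul (by rw [pow_one]; linarith) exp_neg_sq_le (by positivity) (by positivity)

lemma integrable_gauss₂ {d : ℕ} (h j : Fin d) :
    Integrable fun ξ : Sp d => ξ h * (ξ j * Real.exp (-‖ξ‖ ^ 2)) :=
  integrable_of_gaussian_bound (by fun_prop) 1 2 fun ξ => by
    rw [← mul_assoc, abs_mul, abs_mul, abs_of_pos (Real.exp_pos _), one_mul, pow_two (1 + ‖ξ‖)]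
    have h1 := abs_coord_le ξ j
    have h2 := abs_coord_le ξ h
    refine mul_le_mul (mul_le_mul ?_ ?_ ?_ ?_) exp_neg_sq_le ?_ ?_ <;> first | positivity | linarith

lemma integrable_gauss₃ {d : ℕ} (k h j : Fin d) :
    Integrable fun ξ : Sp d => ξ k * (ξ h * (ξ j * Real.exp (-‖ξ‖ ^ 2))) :=
  integrable_of_gaussian_bound (by fun_prop) 1 3 fun ξ => by
    rw [← mul_assoc, ← mul_assoc, abs_mul, abs_mul, abs_mul, abs_of_pos (Real.exp_pos _), one_mul,
      pow_succ (1 + ‖ξ‖), pow_two (1 + ‖ξ‖)]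
    have h1 := abs_coord_le ξ j
    have h2 := abs_coord_le ξ h
    have h3 := abs_coord_le ξ k
    refine mul_le_mul (mul_le_mul (mul_le_mul ?_ ?_ ?_ ?_) ?_ ?_ ?_) exp_neg_sq_le ?_ ?_ <;>
      first | positivity | linarith

/-- The Fourier transform `π^{d/2} e^{-|x|²/4}` of the Gaussian `e^{-|ξ|²}`. -/
noncomputable def gaussHat {d : ℕ} (x : Sp d) : ℝ :=
  Real.pi ^ ((d : ℝ) / 2) * Real.exp (-‖x‖ ^ 2 / 4)

lemma oscInt_gauss {d : ℕ} (x : Sp d) :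
    oscInt (fun ξ : Sp d => Real.exp (-‖ξ‖ ^ 2)) x = gaussHat x := by
  have := GaussianFourier.integral_cexp_neg_mul_sq_norm_add (b := 1) (by simp) Complex.I x
  rw [finrank_euclideanSpace_fin] at this
  unfold oscInt gaussHat
  convert this using 1
  · congr 1; ext ξ
    rw [Complex.ofReal_exp, ← Complex.exp_add]; push_cast; ring_nf
  · rw [Complex.ofReal_mul, Complex.ofReal_cpow Real.pi_pos.le, Complex.ofReal_exp]
    push_cast
    rw [Complex.I_sq]; ring_nf

lemma coord_add_smul_single {d : ℕ} (x : Sp d) (r : ℝ) (h j : Fin d) :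
    (x + r • EuclideanSpace.single h (1 : ℝ)) j = x j + r * kron j h := by
  simp [kron]

lemma hasDerivAt_coord {d : ℕ} (x : Sp d) (h j : Fin d) :
    HasDerivAt (fun r : ℝ => (x + r • EuclideanSpace.single h (1 : ℝ)) j) (kron j h) 0 := by
  simp only [coord_add_smul_single]
  simpa using ((hasDerivAt_id (0 : ℝ)).mul_const (kron j h)).const_add (x j)

lemma hasDerivAt_gaussHat {d : ℕ} (x : Sp d) (h : Fin d) :
    HasDerivAt (fun r : ℝ => gaussHat (x + r • EuclideanSpace.single h (1 : ℝ)))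
      (-(x h / 2) * gaussHat x) 0 := by
  have h1 : ∀ r : ℝ, ‖x + r • EuclideanSpace.single h (1 : ℝ)‖ ^ 2
      = ‖x‖ ^ 2 + 2 * (r * x h) + r ^ 2 := fun r => by
    rw [norm_add_sq_real, real_inner_smul_right, real_inner_comm, inner_single_right', norm_smul,
      PiLp.norm_single, mul_pow]
    simp
  have h2 : HasDerivAt (fun r : ℝ => -(‖x‖ ^ 2 + 2 * (r * x h) + r ^ 2) / 4) (-(x h / 2)) 0 := by
    have := ((((((hasDerivAt_id (0 : ℝ)).mul_const (x h)).const_mul 2).const_add (‖x‖ ^ 2)).add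
      ((hasDerivAt_id (0 : ℝ)).pow 2)).neg.div_const 4)
    refine this.congr_deriv ?_
    simp; ring
  unfold gaussHat
  simp only [h1]
  refine (h2.exp.const_mul _).congr_deriv ?_
  simp; ring

lemma oscInt_gauss₁ {d : ℕ} (j : Fin d) (x : Sp d) :
    oscInt (fun ξ : Sp d => ξ j * Real.exp (-‖ξ‖ ^ 2)) x
      = Complex.I * ((x j / 2 * gaussHat x : ℝ) : ℂ) := by
  have h1 := hasDerivAt_oscInt integrable_gauss j (integrable_gauss₁ j) x
  simp only [oscInt_gauss] at h1
  have h2 := h1.unique (hasDerivAt_gaussHat x j).ofReal_comp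
  calc _ = -Complex.I * (Complex.I * oscInt (fun ξ : Sp d => ξ j * Real.exp (-‖ξ‖ ^ 2)) x) := by
        rw [← mul_assoc, neg_mul, Complex.I_mul_I]; ring
    _ = _ := by rw [h2]; push_cast; ring

lemma oscInt_gauss₂ {d : ℕ} (h j : Fin d) (x : Sp d) :
    oscInt (fun ξ : Sp d => ξ h * (ξ j * Real.exp (-‖ξ‖ ^ 2))) x
      = (((kron j h / 2 - x j * x h / 4) * gaussHat x : ℝ) : ℂ) := by
  have h1 := hasDerivAt_oscInt (integrable_gauss₁ j) h (integrable_gauss₂ h j) x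
  simp only [oscInt_gauss₁] at h1
  have h2 := h1.unique (((((hasDerivAt_coord x h j).div_const 2).mul
    (hasDerivAt_gaussHat x h)).ofReal_comp).const_mul Complex.I)
  have h3 := mul_left_cancel₀ Complex.I_ne_zero h2
  rw [h3, zero_smul, add_zero]
  push_cast; ring

lemma oscInt_gauss₃ {d : ℕ} (k h j : Fin d) (x : Sp d) :
    oscInt (fun ξ : Sp d => ξ k * (ξ h * (ξ j * Real.exp (-‖ξ‖ ^ 2)))) x
      = Complex.I * (((kron j h * x k / 4 + (kron j k * x h + x j * kron h k) / 4
        - x j * x h * x k / 8) * gaussHat x : ℝ) : ℂ) := by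
  have h1 := hasDerivAt_oscInt (integrable_gauss₂ h j) k (integrable_gauss₃ k h j) x
  simp only [oscInt_gauss₂] at h1
  have h2 := h1.unique (((((((hasDerivAt_coord x k j).mul (hasDerivAt_coord x k h)).div_const 4)
    |>.const_sub (kron j h / 2)).mul (hasDerivAt_gaussHat x k)).ofReal_comp))
  calc _ = -Complex.I * (Complex.I *
        oscInt (fun ξ : Sp d => ξ k * (ξ h * (ξ j * Real.exp (-‖ξ‖ ^ 2)))) x) := by
        rw [← mul_assoc, neg_mul, Complex.I_mul_I]; ring
    _ = _ := by rw [h2, Pi.mul_apply, zero_smul, add_zero]; push_cast; ring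

lemma abs_kron_le {d : ℕ} (i j : Fin d) : |kron i j| ≤ 1 := by
  unfold kron; split_ifs <;> simp

/-- A polynomially bounded multiple of the Gaussian decays faster than `|x|^{-d}`. The exponent
`d + 1/2` is integrable at infinity and lies below the critical decay `d + 1` of the kernel. -/
lemma abs_mul_gaussHat_le {d : ℕ} {q : ℝ} (m : ℕ) {x : Sp d} (hq : |q| ≤ (1 + ‖x‖) ^ m) :
    |q * gaussHat x| ≤ Real.pi ^ ((d : ℝ) / 2) * ((m + (d + 1)).factorial * Real.exp 2) *
      (1 + ‖x‖) ^ (-((d : ℝ) + 1 / 2)) := by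
  have hx := norm_nonneg x
  have hg : 0 < gaussHat x := by unfold gaussHat; positivity
  have h1 : 0 < 1 + ‖x‖ := by positivity
  have h2 := one_add_pow_mul_exp_le (m + (d + 1)) hx
  have h3 : (1 + ‖x‖) ^ ((d : ℝ) + 1 / 2) ≤ (1 + ‖x‖) ^ (d + 1) := by
    rw [← Real.rpow_natCast]
    exact Real.rpow_le_rpow_of_exponent_le (by linarith) (by push_cast; linarith)
  rw [abs_mul, abs_of_pos hg, Real.rpow_neg h1.le, ← div_eq_mul_inv, le_div_iff₀ (by positivity)]
  calc _ ≤ (1 + ‖x‖) ^ m * gaussHat x * (1 + ‖x‖) ^ (d + 1) := by gcongr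
    _ = Real.pi ^ ((d : ℝ) / 2) * ((1 + ‖x‖) ^ (m + (d + 1)) * Real.exp (-‖x‖ ^ 2 / 4)) := by
        unfold gaussHat; rw [pow_add]; ring
    _ ≤ _ := by gcongr

lemma exists_norm_oscInt_gauss₁_le {d : ℕ} (j : Fin d) : ∃ C, ∀ x : Sp d,
    ‖oscInt (fun ξ : Sp d => ξ j * Real.exp (-‖ξ‖ ^ 2)) x‖
      ≤ C * (1 + ‖x‖) ^ (-((d : ℝ) + 1 / 2)) := by
  refine ⟨Real.pi ^ ((d : ℝ) / 2) * ((1 + (d + 1)).factorial * Real.exp 2), fun x => ?_⟩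
  rw [oscInt_gauss₁, norm_mul, Complex.norm_I, one_mul, Complex.norm_real, Real.norm_eq_abs]
  refine abs_mul_gaussHat_le 1 ?_
  rw [abs_div, abs_two, pow_one]
  linarith [abs_coord_le x j, abs_nonneg (x j)]

lemma exists_norm_oscInt_gauss₃_le {d : ℕ} (k h j : Fin d) : ∃ C, ∀ x : Sp d,
    ‖oscInt (fun ξ : Sp d => ξ k * (ξ h * (ξ j * Real.exp (-‖ξ‖ ^ 2)))) x‖
      ≤ C * (1 + ‖x‖) ^ (-((d : ℝ) + 1 / 2)) := by
  refine ⟨Real.pi ^ ((d : ℝ) / 2) * ((3 + (d + 1)).factorial * Real.exp 2), fun x => ?_⟩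
  rw [oscInt_gauss₃, norm_mul, Complex.norm_I, one_mul, Complex.norm_real, Real.norm_eq_abs]
  refine abs_mul_gaussHat_le 3 ?_
  have hx := norm_nonneg x
  have hkron : ∀ (i l m : Fin d), |kron i l * x m| ≤ 1 * ‖x‖ := fun i l m => by
    rw [abs_mul]; exact mul_le_mul (abs_kron_le _ _) (abs_coord_le _ _) (abs_nonneg _) one_pos.le
  have e1 := hkron j h k
  have e2 := hkron j k h
  have e3 := hkron h k j
  rw [mul_comm (kron h k)] at e3
  have e4 : |x j * x h * x k| ≤ ‖x‖ * ‖x‖ * ‖x‖ := by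
    rw [abs_mul, abs_mul]
    exact mul_le_mul (mul_le_mul (abs_coord_le _ _) (abs_coord_le _ _) (abs_nonneg _) hx)
      (abs_coord_le _ _) (abs_nonneg _) (by positivity)
  rw [abs_le] at *
  constructor <;> nlinarith [pow_nonneg hx 3, pow_nonneg hx 2]

/-! ### The kernel of `e^{tΔ} ℙ div` -/

/-- The symbol of `ℙ div`, up to the factor `i`. -/
noncomputable def symb {d : ℕ} (j h k : Fin d) (ξ : Sp d) : ℝ :=
  (ξ h * kron j k + ξ k * kron j h) / 2 - ξ j * ξ h * ξ k / ‖ξ‖ ^ 2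

lemma symb_smul {d : ℕ} (j h k : Fin d) {c : ℝ} (hc : 0 < c) (ξ : Sp d) :
    symb j h k (c • ξ) = c * symb j h k ξ := by
  unfold symb
  rw [norm_smul, Real.norm_of_nonneg hc.le]
  simp only [PiLp.smul_apply, smul_eq_mul]
  rcases eq_or_ne ξ 0 with rfl | h0
  · simp
  · have := norm_ne_zero_iff.2 h0
    have := hc.ne'
    field_simp

lemma symb_neg {d : ℕ} (j h k : Fin d) (ξ : Sp d) : symb j h k (-ξ) = -symb j h k ξ := by
  unfold symb; simp only [norm_neg, PiLp.neg_apply]; ring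

lemma abs_cubic_div_le {d : ℕ} (j h k : Fin d) (ξ : Sp d) :
    |ξ j * ξ h * ξ k / ‖ξ‖ ^ 2| ≤ ‖ξ‖ := by
  rcases eq_or_ne ξ 0 with rfl | h0
  · simp
  have hp : 0 < ‖ξ‖ := norm_pos_iff.2 h0
  rw [abs_div, abs_mul, abs_mul, abs_of_pos (pow_pos hp 2), div_le_iff₀ (by positivity)]
  calc _ ≤ ‖ξ‖ * ‖ξ‖ * ‖ξ‖ := by gcongr <;> exact abs_coord_le _ _
    _ = _ := by ring

lemma continuousAt_symb {d : ℕ} (j h k : Fin d) {ξ : Sp d} (h0 : ξ ≠ 0) :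
    ContinuousAt (symb j h k) ξ := by
  unfold symb
  have : ‖ξ‖ ^ 2 ≠ 0 := pow_ne_zero _ (norm_ne_zero_iff.2 h0)
  refine ContinuousAt.sub (by fun_prop) (ContinuousAt.div (by fun_prop) (by fun_prop) this)

lemma integrable_cubic_div {d : ℕ} (j h k : Fin d) :
    Integrable fun ξ : Sp d => ξ j * ξ h * ξ k / ‖ξ‖ ^ 2 * Real.exp (-‖ξ‖ ^ 2) :=
  integrable_of_gaussian_bound (Measurable.aestronglyMeasurable (by fun_prop)) 1 1 fun ξ => by
    rw [abs_mul, abs_of_pos (Real.exp_pos _), one_mul]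
    have := abs_cubic_div_le j h k ξ
    exact mul_le_mul (by rw [pow_one]; linarith) exp_neg_sq_le (by positivity) (by positivity)

lemma gauss_mul_symb {d : ℕ} (j h k : Fin d) (ξ : Sp d) :
    Real.exp (-‖ξ‖ ^ 2) * symb j h k ξ =
      kron j k / 2 * (ξ h * Real.exp (-‖ξ‖ ^ 2)) + kron j h / 2 * (ξ k * Real.exp (-‖ξ‖ ^ 2))
        + (-1) * (ξ j * ξ h * ξ k / ‖ξ‖ ^ 2 * Real.exp (-‖ξ‖ ^ 2)) := by
  unfold symb; ring

lemma integrable_gauss_mul_symb {d : ℕ} (j h k : Fin d) :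
    Integrable fun ξ : Sp d => Real.exp (-‖ξ‖ ^ 2) * symb j h k ξ := by
  simp only [gauss_mul_symb]
  exact (((integrable_gauss₁ h).const_mul _).add ((integrable_gauss₁ k).const_mul _)).add
    ((integrable_cubic_div j h k).const_mul _)

lemma oscInt_gauss_mul_symb {d : ℕ} (j h k : Fin d) (x : Sp d) :
    oscInt (fun ξ : Sp d => Real.exp (-‖ξ‖ ^ 2) * symb j h k ξ) x =
      (kron j k / 2 : ℝ) * oscInt (fun ξ : Sp d => ξ h * Real.exp (-‖ξ‖ ^ 2)) x
      + (kron j h / 2 : ℝ) * oscInt (fun ξ : Sp d => ξ k * Real.exp (-‖ξ‖ ^ 2)) x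
      + (-1 : ℝ) * oscInt (fun ξ : Sp d => ξ j * ξ h * ξ k / ‖ξ‖ ^ 2 * Real.exp (-‖ξ‖ ^ 2)) x := by
  simp only [gauss_mul_symb]
  have hh : Integrable fun ξ : Sp d => kron j k / 2 * (ξ h * Real.exp (-‖ξ‖ ^ 2)) +
      kron j h / 2 * (ξ k * Real.exp (-‖ξ‖ ^ 2)) :=
    ((integrable_gauss₁ h).const_mul _).add ((integrable_gauss₁ k).const_mul _)
  rw [oscInt_add hh ((integrable_cubic_div j h k).const_mul _),
    oscInt_add ((integrable_gauss₁ h).const_mul _)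
    ((integrable_gauss₁ k).const_mul _)]
  simp only [oscInt_const_mul]

lemma kernelF_eq {d : ℕ} (j h k : Fin d) (t : ℝ) (x : Sp d) :
    kernelF j h k t x = ((2 * Real.pi) ^ d)⁻¹ *
      (Complex.I * oscInt (fun ξ => Real.exp (-(t * ‖ξ‖ ^ 2)) * symb j h k ξ) x).re := by
  unfold kernelF oscInt symb
  rw [← integral_const_mul Complex.I, ← Complex.ofReal_pow, ← Complex.ofReal_inv,
    Complex.re_ofReal_mul]
  congr 3 with ξ
  beta_reduce
  rw [Complex.exp_add, Complex.ofReal_mul (Real.exp _), Complex.ofReal_exp, Complex.ofReal_neg]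
  ring

/-- The parabolic self-similarity of the kernel. -/
lemma kernelF_scale {d : ℕ} (j h k : Fin d) {c : ℝ} (hc : 0 < c) (τ : ℝ) (z : Sp d) :
    kernelF j h k (c ^ 2 * τ) (c • z) = (c ^ (d + 1))⁻¹ * kernelF j h k τ z := by
  have e : (fun ξ : Sp d => Real.exp (-(c ^ 2 * τ * ‖ξ‖ ^ 2)) * symb j h k ξ) =
      fun ξ => c⁻¹ * (fun η : Sp d => Real.exp (-(τ * ‖η‖ ^ 2)) * symb j h k η) (c • ξ) := by
    ext ξ
    simp only [symb_smul j h k hc, norm_smul, Real.norm_of_nonneg hc.le]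
    have := hc.ne'
    field_simp
  rw [kernelF_eq, kernelF_eq, e, oscInt_const_mul,
    oscInt_comp_smul (fun η : Sp d => Real.exp (-(τ * ‖η‖ ^ 2)) * symb j h k η) hc,
    inv_smul_smul₀ hc.ne', ← mul_assoc Complex.I, mul_comm Complex.I, mul_assoc,
    Complex.re_ofReal_mul,
    ← mul_assoc Complex.I, mul_comm Complex.I, mul_assoc, Complex.re_ofReal_mul, pow_succ]
  have := hc.ne'
  field_simp

/-- The kernel at time `τ` expressed through its profile at time `1`. -/
lemma kernelF_eq_profile {d : ℕ} (j h k : Fin d) {τ : ℝ} (hτ : 0 < τ) (z : Sp d) :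
    kernelF j h k τ z = (√τ ^ (d + 1))⁻¹ * kernelF j h k 1 ((√τ)⁻¹ • z) := by
  have hs := Real.sqrt_pos.2 hτ
  have := kernelF_scale j h k hs 1 ((√τ)⁻¹ • z)
  rwa [Real.sq_sqrt hτ.le, mul_one, smul_inv_smul₀ hs.ne'] at this

lemma continuous_kernelF_one {d : ℕ} (j h k : Fin d) : Continuous (kernelF j h k 1) := by
  have e : kernelF j h k 1 = fun x => ((2 * Real.pi) ^ d)⁻¹ *
      (Complex.I * oscInt (fun ξ => Real.exp (-‖ξ‖ ^ 2) * symb j h k ξ) x).re := by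
    ext x; rw [kernelF_eq]; simp only [one_mul]
  have := continuous_oscInt (integrable_gauss_mul_symb j h k)
  rw [e]; fun_prop

lemma integral_Ioi_exp_neg_mul {r : ℝ} (hr : 0 < r) :
    IntegrableOn (fun s : ℝ => Real.exp (-(s * r))) (Set.Ioi 1) ∧
      ∫ s in Set.Ioi (1 : ℝ), Real.exp (-(s * r)) = Real.exp (-r) / r := by
  have e : (fun s : ℝ => Real.exp (-(s * r))) = fun s => Real.exp (-r * s) := by
    ext s; ring_nf
  rw [e]
  refine ⟨integrableOn_exp_mul_Ioi (by linarith) 1, ?_⟩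
  rw [integral_exp_mul_Ioi (by linarith), mul_one, neg_div_neg_eq]

/-- Writing `|ξ|⁻² e^{-|ξ|²} = ∫₁^∞ e^{-s|ξ|²} ds` expresses the nonlocal part of the kernel through
third derivatives of Gaussians. -/
lemma oscInt_cubic_div_eq {d : ℕ} (j h k : Fin d) (x : Sp d) :
    oscInt (fun ξ : Sp d => ξ j * ξ h * ξ k / ‖ξ‖ ^ 2 * Real.exp (-‖ξ‖ ^ 2)) x =
      ∫ s in Set.Ioi (1 : ℝ),
        oscInt (fun ξ : Sp d => ξ j * ξ h * ξ k * Real.exp (-(s * ‖ξ‖ ^ 2))) x := by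
  unfold oscInt
  have hsl : ∀ (q : ℝ → ℝ), q 0 = 0 → ∀ ξ : Sp d,
      IntegrableOn (fun s : ℝ => q (ξ j * ξ h * ξ k) * Real.exp (-(s * ‖ξ‖ ^ 2))) (Set.Ioi 1) ∧
      ∫ s in Set.Ioi (1 : ℝ), q (ξ j * ξ h * ξ k) * Real.exp (-(s * ‖ξ‖ ^ 2)) =
        q (ξ j * ξ h * ξ k) / ‖ξ‖ ^ 2 * Real.exp (-‖ξ‖ ^ 2) := fun q hq ξ => by
    rcases eq_or_ne ξ 0 with rfl | h0
    · simp [hq]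
    obtain ⟨h1, h2⟩ := integral_Ioi_exp_neg_mul (pow_pos (norm_pos_iff.2 h0) 2)
    refine ⟨h1.const_mul _, ?_⟩
    rw [integral_const_mul, h2]; ring
  refine Eq.trans ?_ (integral_integral_swap (f := fun (ξ : Sp d) (s : ℝ) =>
    ((ξ j * ξ h * ξ k * Real.exp (-(s * ‖ξ‖ ^ 2)) : ℝ) : ℂ) *
      Complex.exp (Complex.I * ((inner ℝ x ξ : ℝ) : ℂ))) ?_)
  · congr 1; ext ξ
    rw [integral_mul_const, integral_complex_ofReal]
    congr 2
    exact (hsl id rfl ξ).2.symm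
  · have hmeas : AEStronglyMeasurable (Function.uncurry fun (ξ : Sp d) (s : ℝ) =>
        ((ξ j * ξ h * ξ k * Real.exp (-(s * ‖ξ‖ ^ 2)) : ℝ) : ℂ) *
          Complex.exp (Complex.I * ((inner ℝ x ξ : ℝ) : ℂ)))
        ((volume : Measure (Sp d)).prod (volume.restrict (Set.Ioi 1))) := by
      refine Continuous.aestronglyMeasurable ?_
      simp only [Function.uncurry_def]
      fun_prop
    rw [integrable_prod_iff hmeas]
    refine ⟨ae_of_all _ fun ξ => ?_, ?_⟩
    · have h1 : IntegrableOn (fun s : ℝ => ξ j * ξ h * ξ k * Real.exp (-(s * ‖ξ‖ ^ 2)))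
        (Set.Ioi 1) := (hsl id rfl ξ).1
      have h2 : Integrable (fun s : ℝ => ((ξ j * ξ h * ξ k * Real.exp (-(s * ‖ξ‖ ^ 2)) : ℝ) : ℂ))
        (volume.restrict (Set.Ioi 1)) := h1.ofReal
      exact h2.mul_const (Complex.exp (Complex.I * ((inner ℝ x ξ : ℝ) : ℂ)))
    refine (integrable_cubic_div j h k).norm.congr (ae_of_all _ fun ξ => ?_)
    simp only [Function.uncurry_apply_pair, norm_mul, norm_exp_I_mul, mul_one, Complex.norm_real,
      Real.norm_eq_abs, Real.abs_exp, norm_div, norm_pow, abs_norm]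
    simpa only [abs_mul] using (hsl abs abs_zero ξ).2.symm

lemma exists_norm_oscInt_cubic_div_le {d : ℕ} (j h k : Fin d) : ∃ C, ∀ x : Sp d,
    ‖oscInt (fun ξ : Sp d => ξ j * ξ h * ξ k / ‖ξ‖ ^ 2 * Real.exp (-‖ξ‖ ^ 2)) x‖
      ≤ C * (1 + ‖x‖) ^ (-((d : ℝ) + 1 / 2)) := by
  obtain ⟨C, hC⟩ := exists_norm_oscInt_gauss₃_le j h k
  refine ⟨∫ s in Set.Ioi (1 : ℝ), C * s ^ (-(5 / 4) : ℝ), fun x => ?_⟩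
  rw [oscInt_cubic_div_eq, ← integral_mul_const]
  refine norm_integral_le_of_norm_le ?_ ?_
  · exact ((integrableOn_Ioi_rpow_of_lt (by norm_num) one_pos).const_mul C).mul_const _
  refine (ae_restrict_mem measurableSet_Ioi).mono fun s (hs : 1 < s) => ?_
  have hs0 : 0 < s := by linarith
  set c := √s with hc
  have hc1 : 1 < c := Real.lt_sqrt_of_sq_lt (by simpa using hs)
  have hc0 : 0 < c := by linarith
  have e : (fun ξ : Sp d => ξ j * ξ h * ξ k * Real.exp (-(s * ‖ξ‖ ^ 2))) = fun ξ => (c ^ 3)⁻¹ *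
      (fun η : Sp d => η j * (η h * (η k * Real.exp (-‖η‖ ^ 2)))) (c • ξ) := by
    ext ξ
    simp only [norm_smul, Real.norm_of_nonneg hc0.le, mul_pow, PiLp.smul_apply, smul_eq_mul]
    rw [hc, Real.sq_sqrt hs0.le, ← hc]
    have := hc0.ne'
    field_simp
  rw [e, oscInt_const_mul,
    oscInt_comp_smul (fun η : Sp d => η j * (η h * (η k * Real.exp (-‖η‖ ^ 2)))) hc0, norm_mul,
    norm_mul, Complex.norm_real, Complex.norm_real, Real.norm_of_nonneg (by positivity),
    Real.norm_of_nonneg (by positivity)]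
  have h2 := hC (c⁻¹ • x)
  rw [norm_smul, Real.norm_of_nonneg (by positivity)] at h2
  have h3 : (1 + c⁻¹ * ‖x‖) ^ (-((d : ℝ) + 1 / 2)) ≤
      c ^ ((d : ℝ) + 1 / 2) * (1 + ‖x‖) ^ (-((d : ℝ) + 1 / 2)) := by
    calc (1 + c⁻¹ * ‖x‖) ^ (-((d : ℝ) + 1 / 2)) ≤ (c⁻¹ * (1 + ‖x‖)) ^ (-((d : ℝ) + 1 / 2)) := by
          refine Real.rpow_le_rpow_of_nonpos (by positivity) ?_ ?_
          · rw [mul_add, mul_one]; gcongr; exact inv_le_one_of_one_le₀ hc1.le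
          · have : (0 : ℝ) ≤ d := Nat.cast_nonneg d
            linarith
      _ = _ := by
          rw [Real.mul_rpow (by positivity) (by positivity), Real.inv_rpow hc0.le,
            Real.rpow_neg hc0.le, inv_inv]
  have hCn : 0 ≤ C := by
    have := (norm_nonneg _).trans (hC 0)
    simpa using this
  have h4 : s ^ (-(5 / 4) : ℝ) = (c ^ 3)⁻¹ * ((c ^ d)⁻¹ * c ^ ((d : ℝ) + 1 / 2)) := by
    have : s = c ^ (2 : ℝ) := by rw [Real.rpow_two, hc, Real.sq_sqrt hs0.le]
    rw [this, ← Real.rpow_mul hc0.le, ← Real.rpow_natCast, ← Real.rpow_natCast,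
      ← Real.rpow_neg hc0.le, ← Real.rpow_neg hc0.le, ← Real.rpow_add hc0, ← Real.rpow_add hc0]
    congr 1; push_cast; ring
  calc _ ≤ (c ^ 3)⁻¹ * ((c ^ d)⁻¹ * (C * (c ^ ((d : ℝ) + 1 / 2) *
        (1 + ‖x‖) ^ (-((d : ℝ) + 1 / 2))))) := by
        gcongr; exact h2.trans (by gcongr)
    _ = _ := by rw [h4]; ring

/-- The profile of the kernel decays faster than is needed for integrability. -/
lemma exists_kernelF_one_le {d : ℕ} (j h k : Fin d) : ∃ C, ∀ x : Sp d,
    |kernelF j h k 1 x| ≤ C * (1 + ‖x‖) ^ (-((d : ℝ) + 1 / 2)) := by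
  obtain ⟨A, hA⟩ := exists_norm_oscInt_gauss₁_le h
  obtain ⟨B, hB⟩ := exists_norm_oscInt_gauss₁_le k
  obtain ⟨C, hC⟩ := exists_norm_oscInt_cubic_div_le j h k
  refine ⟨((2 * Real.pi) ^ d)⁻¹ * (A + B + C), fun x => ?_⟩
  rw [kernelF_eq, abs_mul, abs_of_pos (by positivity), mul_assoc]
  refine mul_le_mul_of_nonneg_left ?_ (by positivity)
  refine (Complex.abs_re_le_norm _).trans ?_
  rw [norm_mul, Complex.norm_I, one_mul]
  simp only [one_mul]
  have hk : ∀ i l : Fin d, ‖((kron i l / 2 : ℝ) : ℂ)‖ ≤ 1 := fun i l => by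
    rw [Complex.norm_real, Real.norm_eq_abs, abs_div, abs_two]
    linarith [abs_kron_le i l, abs_nonneg (kron i l)]
  rw [oscInt_gauss_mul_symb, add_mul, add_mul]
  refine (norm_add₃_le).trans (add_le_add_three ?_ ?_ ?_)
  · rw [norm_mul]
    exact (mul_le_of_le_one_left (norm_nonneg _) (hk j k)).trans (hA x)
  · rw [norm_mul]
    exact (mul_le_of_le_one_left (norm_nonneg _) (hk j h)).trans (hB x)
  · rw [norm_mul, Complex.norm_real, norm_neg, norm_one, one_mul]
    exact hC x

lemma integrable_kernelF_one {d : ℕ} (j h k : Fin d) : Integrable (kernelF j h k 1) := by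
  obtain ⟨C, hC⟩ := exists_kernelF_one_le j h k
  have hi : Integrable fun ξ : Sp d => (1 + ‖ξ‖) ^ (-((d : ℝ) + 1 / 2)) :=
    integrable_one_add_norm (by rw [finrank_euclideanSpace_fin]; linarith)
  exact (hi.const_mul C).mono' (continuous_kernelF_one j h k).aestronglyMeasurable
    (ae_of_all _ hC)

lemma exists_kernelF_one_bounded {d : ℕ} (j h k : Fin d) : ∃ C, 0 ≤ C ∧ ∀ x : Sp d,
    |kernelF j h k 1 x| ≤ C := by
  obtain ⟨C, hC⟩ := exists_kernelF_one_le j h k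
  have hCn : 0 ≤ C := by
    have := (abs_nonneg _).trans (hC 0)
    simpa using this
  refine ⟨C, hCn, fun x => (hC x).trans ?_⟩
  refine mul_le_of_le_one_right hCn (Real.rpow_le_one_of_one_le_of_nonpos ?_ ?_)
  · linarith [norm_nonneg x]
  · have : (0 : ℝ) ≤ d := Nat.cast_nonneg d
    linarith

/-! ### Decaying sources -/

/-- The properties of a product `w = u_h u_k` of two velocity components that govern the Duhamel
integral: integrability in space and time, decay in time of the sup norm, and
continuity in time with values in `L¹`. -/
structure IsDecayingSource {d : ℕ} (A : ℝ) (w : ℝ → Sp d → ℝ) : Prop where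
  meas : ∀ s, 0 ≤ s → AEStronglyMeasurable (w s) volume
  space : ∀ s, 0 ≤ s → ∀ᵐ y, |w s y| ≤
    A * (1 + s) ^ (-((d : ℝ) + 1) / 2) * (1 + ‖y‖) ^ (-((d : ℝ) + 1))
  time : ∀ s, 0 ≤ s → ∀ᵐ y, |w s y| ≤ A * (1 + s) ^ (-((d : ℝ) + 1))
  cont : ∀ s, 0 < s → Tendsto (fun s' => ∫ y, |w s' y - w s y|) (𝓝 s) (𝓝 0)

/-- The integral of the weight `(1+|y|)^{-(d+1)}`. -/
noncomputable def weightMass (d : ℕ) : ℝ := ∫ y : Sp d, (1 + ‖y‖) ^ (-((d : ℝ) + 1))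

lemma integrable_weight (d : ℕ) : Integrable fun y : Sp d => (1 + ‖y‖) ^ (-((d : ℝ) + 1)) :=
  integrable_one_add_norm (by rw [finrank_euclideanSpace_fin]; linarith)

lemma integrableOn_time_weight {d : ℕ} (hd : 2 ≤ d) :
    IntegrableOn (fun s : ℝ => (1 + s) ^ (-((d : ℝ) + 1) / 2)) (Set.Ioi 0) := by
  have hd' : (2 : ℝ) ≤ d := by exact_mod_cast hd
  simp only [add_comm (1 : ℝ)]
  exact integrableOn_add_rpow_Ioi_of_lt (by linarith) (by norm_num)

namespace IsDecayingSource

variable {d : ℕ} {A : ℝ} {w : ℝ → Sp d → ℝ}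

lemma integrable (hw : IsDecayingSource A w) {s : ℝ} (hs : 0 ≤ s) : Integrable (w s) :=
  ((integrable_weight d).const_mul _).mono' (hw.meas s hs) (hw.space s hs)

lemma integral_abs_le (hw : IsDecayingSource A w) {s : ℝ} (hs : 0 ≤ s) :
    ∫ y, |w s y| ≤ A * weightMass d * (1 + s) ^ (-((d : ℝ) + 1) / 2) := by
  have := integral_mono_ae (hw.integrable hs).abs ((integrable_weight d).const_mul _)
    (hw.space s hs)
  rw [integral_const_mul] at this
  refine this.trans (le_of_eq ?_)
  unfold weightMass; ring

lemma nonneg (hw : IsDecayingSource A w) : 0 ≤ A := by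
  obtain ⟨y, hy⟩ := (hw.time 0 le_rfl).exists
  have := (abs_nonneg _).trans hy
  simpa using this

lemma integrable_mul (hw : IsDecayingSource A w) {s : ℝ} (hs : 0 ≤ s) {g : Sp d → ℝ} {B : ℝ}
    (hg : AEStronglyMeasurable g volume) (hB : ∀ y, |g y| ≤ B) :
    Integrable fun y => g y * w s y :=
  (hw.integrable hs).bdd_mul hg (ae_of_all _ hB)

lemma abs_integral_mul_le (hw : IsDecayingSource A w) {s : ℝ} (hs : 0 ≤ s) {g : Sp d → ℝ} {B : ℝ}
    (hB : ∀ y, |g y| ≤ B) :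
    |∫ y, g y * w s y| ≤ B * (A * weightMass d * (1 + s) ^ (-((d : ℝ) + 1) / 2)) := by
  have hB0 : 0 ≤ B := (abs_nonneg _).trans (hB 0)
  have := norm_integral_le_of_norm_le (f := fun y => g y * w s y)
    ((hw.integrable hs).abs.const_mul B)
    (ae_of_all _ fun y => by
      rw [norm_mul]; exact mul_le_mul_of_nonneg_right (hB y) (norm_nonneg _))
  rw [integral_const_mul] at this
  exact this.trans (mul_le_mul_of_nonneg_left (hw.integral_abs_le hs) hB0)

/-- Pairing a decaying source with bounded, pointwise continuous weights is continuous in time. -/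
lemma continuousAt_pairing (hw : IsDecayingSource A w) {s₀ : ℝ} (hs₀ : 0 < s₀)
    {g : ℝ → Sp d → ℝ} {B : ℝ} (hg : ∀ᶠ s in 𝓝 s₀, AEStronglyMeasurable (g s) volume)
    (hB : ∀ᶠ s in 𝓝 s₀, ∀ y, |g s y| ≤ B)
    (hlim : ∀ y, Tendsto (fun s => g s y) (𝓝 s₀) (𝓝 (g s₀ y))) :
    ContinuousAt (fun s => ∫ y, g s y * w s y) s₀ := by
  have hpos : ∀ᶠ s in 𝓝 s₀, 0 ≤ s := (lt_mem_nhds hs₀).mono fun s h => h.le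
  have e : ∀ᶠ s in 𝓝 s₀, ∫ y, g s y * w s y =
      (∫ y, g s y * (w s y - w s₀ y)) + ∫ y, g s y * w s₀ y := by
    filter_upwards [hg, hB, hpos] with s h1 h2 h3
    have i1 := hw.integrable_mul h3 h1 h2
    have i2 := hw.integrable_mul hs₀.le h1 h2
    rw [← integral_add _ i2]
    · congr 1; ext y; ring
    · simp only [mul_sub]; exact i1.sub i2
  -- The sources converge in `L¹` only, hence the splitting: the weights are bounded in the first
  -- term, and dominated convergence applies to the fixed source in the second.
  have t1 : Tendsto (fun s => ∫ y, g s y * (w s y - w s₀ y)) (𝓝 s₀) (𝓝 0) := by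
    refine squeeze_zero_norm' (a := fun s => B * ∫ y, |w s y - w s₀ y|) ?_ ?_
    · filter_upwards [hB, hpos] with s h2 h3
      rw [← integral_const_mul]
      refine norm_integral_le_of_norm_le
        (((hw.integrable h3).sub (hw.integrable hs₀.le)).abs.const_mul B) (ae_of_all _ fun y => ?_)
      rw [norm_mul]
      exact mul_le_mul_of_nonneg_right (h2 y) (norm_nonneg _)
    · simpa using (hw.cont s₀ hs₀).const_mul B
  have t2 : Tendsto (fun s => ∫ y, g s y * w s₀ y) (𝓝 s₀) (𝓝 (∫ y, g s₀ y * w s₀ y)) := by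
    refine tendsto_integral_filter_of_dominated_convergence (fun y => B * |w s₀ y|) ?_ ?_
      ((hw.integrable hs₀.le).abs.const_mul B) (ae_of_all _ fun y => (hlim y).mul_const _)
    · exact hg.mono fun s h => h.mul (hw.meas s₀ hs₀.le)
    · refine hB.mono fun s h => ae_of_all _ fun y => ?_
      rw [norm_mul]
      exact mul_le_mul_of_nonneg_right (h y) (norm_nonneg _)
  have := t1.add t2
  rw [zero_add] at this
  exact this.congr' (e.mono fun s h => h.symm)

lemma integrableOn_mass (hw : IsDecayingSource A w) (hd : 2 ≤ d) :
    IntegrableOn (fun s => ∫ y, w s y) (Set.Ioi 0) := by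
  refine ((integrableOn_time_weight hd).const_mul (A * weightMass d)).mono' ?_ ?_
  · refine ContinuousOn.aestronglyMeasurable (fun s hs => ?_) measurableSet_Ioi
    have := hw.continuousAt_pairing (s₀ := s) hs (g := fun _ _ => 1) (B := 1)
      (Eventually.of_forall fun _ => aestronglyMeasurable_const)
      (Eventually.of_forall fun _ _ => by simp) (fun _ => tendsto_const_nhds)
    simp only [one_mul] at this
    exact this.continuousWithinAt
  · refine (ae_restrict_mem measurableSet_Ioi).mono fun s (hs : 0 < s) => ?_
    exact (abs_integral_le_integral_abs).trans (hw.integral_abs_le hs.le)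

lemma tendsto_mass (hw : IsDecayingSource A w) (hd : 2 ≤ d) :
    Tendsto (fun t => ∫ s in (0 : ℝ)..t, ∫ y, w s y) atTop
      (𝓝 (∫ s in Set.Ioi (0 : ℝ), ∫ y, w s y)) :=
  intervalIntegral_tendsto_integral_Ioi 0 (hw.integrableOn_mass hd) tendsto_id

end IsDecayingSource

/-! ### The Duhamel integral at the parabolic scale -/

section Duhamel

variable {d : ℕ}

lemma abs_kernelF_le {j h k : Fin d} {B : ℝ} (hB : ∀ x, |kernelF j h k 1 x| ≤ B) {τ : ℝ}
    (hτ : 0 < τ) (z : Sp d) : |kernelF j h k τ z| ≤ (√τ ^ (d + 1))⁻¹ * B := by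
  have hs := Real.sqrt_pos.2 hτ
  rw [kernelF_eq_profile j h k hτ, abs_mul, abs_of_pos (by positivity)]
  exact mul_le_mul_of_nonneg_left (hB _) (by positivity)

lemma continuous_kernelF (j h k : Fin d) {τ : ℝ} (hτ : 0 < τ) : Continuous (kernelF j h k τ) := by
  have e : kernelF j h k τ = fun z => (√τ ^ (d + 1))⁻¹ * kernelF j h k 1 ((√τ)⁻¹ • z) := by
    ext z; exact kernelF_eq_profile j h k hτ z
  have := continuous_kernelF_one j h k
  rw [e]; fun_prop

/-- Joint continuity of the kernel, in the form of a limit along two given functions. -/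
lemma tendsto_kernelF {ι : Type*} {l : Filter ι} (j h k : Fin d) {τ : ι → ℝ} {z : ι → Sp d}
    {τ₀ : ℝ} {z₀ : Sp d} (hτ₀ : 0 < τ₀) (hτ : Tendsto τ l (𝓝 τ₀)) (hz : Tendsto z l (𝓝 z₀)) :
    Tendsto (fun i => kernelF j h k (τ i) (z i)) l (𝓝 (kernelF j h k τ₀ z₀)) := by
  have hs : √τ₀ ≠ 0 := (Real.sqrt_pos.2 hτ₀).ne'
  have h1 : Tendsto (fun i => √(τ i)) l (𝓝 √τ₀) := hτ.sqrt
  have h2 := ((h1.pow (d + 1)).inv₀ (pow_ne_zero _ hs)).mul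
    (((continuous_kernelF_one j h k).tendsto _).comp ((h1.inv₀ hs).smul hz))
  rw [← kernelF_eq_profile j h k hτ₀] at h2
  refine h2.congr' ?_
  filter_upwards [hτ.eventually (lt_mem_nhds hτ₀)] with i hi
  rw [kernelF_eq_profile j h k hi]; rfl

lemma integrable_kernelF (j h k : Fin d) {τ : ℝ} (hτ : 0 < τ) :
    Integrable (kernelF j h k τ) := by
  have hs := Real.sqrt_pos.2 hτ
  have e : kernelF j h k τ = fun z => (√τ ^ (d + 1))⁻¹ * kernelF j h k 1 ((√τ)⁻¹ • z) := by
    ext z; exact kernelF_eq_profile j h k hτ z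
  rw [e]
  exact ((integrable_comp_smul_iff volume _ (inv_ne_zero hs.ne')).2
    (integrable_kernelF_one j h k)).const_mul _

lemma integral_abs_kernelF (j h k : Fin d) {τ : ℝ} (hτ : 0 < τ) :
    ∫ z, |kernelF j h k τ z| = (√τ)⁻¹ * ∫ z, |kernelF j h k 1 z| := by
  have hs := Real.sqrt_pos.2 hτ
  have e : ∀ z, |kernelF j h k τ z| =
      (√τ ^ (d + 1))⁻¹ * (fun y => |kernelF j h k 1 y|) ((√τ)⁻¹ • z) := fun z => by
    rw [kernelF_eq_profile j h k hτ z, abs_mul, abs_of_pos (by positivity)]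
  rw [funext e, integral_const_mul,
    Measure.integral_comp_smul volume (fun y => |kernelF j h k 1 y|), finrank_euclideanSpace_fin,
    smul_eq_mul, abs_of_pos (by positivity), pow_succ, inv_pow, inv_inv]
  have := (pow_pos hs d).ne'
  field_simp

/-- The kernel at the point `√t x - y` at time `t - s`, in parabolic units. -/
lemma kernelF_parabolic (j h k : Fin d) {t : ℝ} (ht : 0 < t) (s : ℝ) (x y : Sp d) :
    √t ^ (d + 1) * kernelF j h k (t - s) (√t • x - y) =
      kernelF j h k (1 - s / t) (x - (√t)⁻¹ • y) := by
  have hs := Real.sqrt_pos.2 ht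
  have := kernelF_scale j h k hs (1 - s / t) (x - (√t)⁻¹ • y)
  rw [Real.sq_sqrt ht.le, smul_sub, smul_inv_smul₀ hs.ne',
    show t * (1 - s / t) = t - s by field_simp] at this
  rw [this, mul_inv_cancel_left₀ (by positivity)]

/-- The integrand in time of the Duhamel integral at the point `√t x`, times `t^{(d+1)/2}`. -/
noncomputable def duhamelSlice (j h k : Fin d) (w : ℝ → Sp d → ℝ) (x : Sp d) (t s : ℝ) : ℝ :=
  √t ^ (d + 1) * ∫ y, kernelF j h k (t - s) (√t • x - y) * w s y

variable {A : ℝ} {w : ℝ → Sp d → ℝ}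

lemma duhamelSlice_eq (j h k : Fin d) (x : Sp d) {t : ℝ} (ht : 0 < t) (s : ℝ) :
    duhamelSlice j h k w x t s =
      ∫ y, kernelF j h k (1 - s / t) (x - (√t)⁻¹ • y) * w s y := by
  unfold duhamelSlice
  rw [← integral_const_mul]
  congr 1; ext y
  rw [← mul_assoc, kernelF_parabolic j h k ht]

lemma sqrt_inv_pow_le {τ : ℝ} (hτ : 1 / 2 ≤ τ) (n : ℕ) : (√τ ^ n)⁻¹ ≤ 2 ^ n := by
  have h1 : 1 / 2 ≤ √τ := Real.le_sqrt_of_sq_le (by linarith)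
  rw [← inv_pow]
  refine pow_le_pow_left₀ (by positivity) ?_ n
  rw [inv_le_comm₀ (by linarith) two_pos]; linarith

lemma aestronglyMeasurable_duhamelSlice (hw : IsDecayingSource A w) (j h k : Fin d) (x : Sp d)
    (t : ℝ) : AEStronglyMeasurable (duhamelSlice j h k w x t) (volume.restrict (Set.Ioc 0 t)) := by
  obtain ⟨B, hB0, hB⟩ := exists_kernelF_one_bounded j h k
  rw [← restrict_Ioo_eq_restrict_Ioc]
  refine ContinuousOn.aestronglyMeasurable (fun s hs => ?_) measurableSet_Ioo
  have hts : 0 < t - s := sub_pos.2 hs.2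
  have hev : ∀ᶠ s' in 𝓝 s, (t - s) / 2 < t - s' := by
    filter_upwards [gt_mem_nhds (show s < (t + s) / 2 by linarith)] with s' h; linarith
  refine (continuousAt_const.mul (hw.continuousAt_pairing hs.1
    (g := fun s' y => kernelF j h k (t - s') (√t • x - y))
    (B := (√((t - s) / 2) ^ (d + 1))⁻¹ * B) ?_ ?_ ?_)).continuousWithinAt
  · refine hev.mono fun s' h' => Continuous.aestronglyMeasurable ?_
    have := continuous_kernelF j h k (show 0 < t - s' by linarith)
    fun_prop
  · refine hev.mono fun s' h' y => (abs_kernelF_le hB (by linarith) _).trans ?_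
    have : 0 < √((t - s) / 2) := Real.sqrt_pos.2 (by linarith)
    gcongr
  · exact fun y => tendsto_kernelF j h k hts
      ((continuous_const.sub continuous_id).tendsto s) tendsto_const_nhds

/-- Bound of the slices away from the singular time `s = t`. -/
lemma abs_duhamelSlice_near (hw : IsDecayingSource A w) {j h k : Fin d} {B : ℝ} (hB0 : 0 ≤ B)
    (hB : ∀ x, |kernelF j h k 1 x| ≤ B) (x : Sp d) {t s : ℝ} (hs : 0 < s) (hst : s ≤ t / 2) :
    |duhamelSlice j h k w x t s| ≤
      2 ^ (d + 1) * B * (A * weightMass d * (1 + s) ^ (-((d : ℝ) + 1) / 2)) := by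
  have ht : 0 < t := by linarith
  have hτ : 1 / 2 ≤ 1 - s / t := by
    have : s / t ≤ 1 / 2 := by rw [div_le_iff₀ ht]; linarith
    linarith
  rw [duhamelSlice_eq j h k x ht]
  refine hw.abs_integral_mul_le hs.le fun y => (abs_kernelF_le hB (by linarith) _).trans ?_
  exact mul_le_mul_of_nonneg_right (sqrt_inv_pow_le hτ _) hB0

/-- Bound of the slices near the singular time `s = t`, from the `L¹` norm of the kernel. -/
lemma abs_duhamelSlice_far (hw : IsDecayingSource A w) (j h k : Fin d) (x : Sp d) {t s : ℝ}
    (hst : t / 2 ≤ s) (hs : s < t) :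
    |duhamelSlice j h k w x t s| ≤
      A * (∫ z, |kernelF j h k 1 z|) * 2 ^ (d + 1) * (√t ^ (d + 1))⁻¹ *
        (t - s) ^ (-(1 / 2) : ℝ) := by
  have ht : 0 < t := by linarith
  have hts : 0 < t - s := by linarith
  have hA := hw.nonneg
  have h1 : |∫ y, kernelF j h k (t - s) (√t • x - y) * w s y| ≤
      A * (1 + s) ^ (-((d : ℝ) + 1)) * ((√(t - s))⁻¹ * ∫ z, |kernelF j h k 1 z|) := by
    rw [← integral_abs_kernelF j h k hts,
      ← integral_sub_left_eq_self (fun z => |kernelF j h k (t - s) z|) volume (√t • x),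
      ← integral_const_mul]
    refine norm_integral_le_of_norm_le (f := fun y => kernelF j h k (t - s) (√t • x - y) * w s y)
      (((integrable_kernelF j h k hts).comp_sub_left (√t • x)).abs.const_mul _) ?_
    filter_upwards [hw.time s (by linarith)] with y hy
    rw [norm_mul, mul_comm]
    exact mul_le_mul_of_nonneg_right hy (norm_nonneg _)
  have h2 : (1 + s) ^ (-((d : ℝ) + 1)) ≤ 2 ^ (d + 1) * (√t ^ (d + 1) * √t ^ (d + 1))⁻¹ := by
    rw [← mul_pow, Real.mul_self_sqrt ht.le, Real.rpow_neg (by linarith), ← inv_pow, ← mul_pow,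
      show ((d : ℝ) + 1) = ((d + 1 : ℕ) : ℝ) by push_cast; rfl, Real.rpow_natCast, ← inv_pow]
    refine pow_le_pow_left₀ (inv_nonneg.2 (by linarith)) ?_ _
    rw [inv_le_comm₀ (by linarith) (by positivity), mul_inv, inv_inv]
    linarith
  have h3 : (t - s) ^ (-(1 / 2) : ℝ) = (√(t - s))⁻¹ := by
    rw [Real.rpow_neg hts.le, Real.sqrt_eq_rpow]
  have hI : 0 ≤ ∫ z, |kernelF j h k 1 z| := integral_nonneg fun _ => abs_nonneg _
  unfold duhamelSlice
  rw [abs_mul, abs_of_pos (by positivity), h3]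
  calc _ ≤ √t ^ (d + 1) * (A * (2 ^ (d + 1) * (√t ^ (d + 1) * √t ^ (d + 1))⁻¹) *
        ((√(t - s))⁻¹ * ∫ z, |kernelF j h k 1 z|)) := by
        gcongr; exact h1.trans (by gcongr)
    _ = _ := by
        have : √t ≠ 0 := (Real.sqrt_pos.2 ht).ne'
        field_simp

/-- At a fixed time `s` the source concentrates at the origin in parabolic units. -/
lemma tendsto_duhamelSlice (hw : IsDecayingSource A w) (j h k : Fin d) (x : Sp d) {s : ℝ}
    (hs : 0 < s) : Tendsto (fun t => duhamelSlice j h k w x t s) atTop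
      (𝓝 (kernelF j h k 1 x * ∫ y, w s y)) := by
  obtain ⟨B, hB0, hB⟩ := exists_kernelF_one_bounded j h k
  have hτ : Tendsto (fun t : ℝ => 1 - s / t) atTop (𝓝 1) := by
    simpa using (tendsto_const_nhds (x := s)).div_atTop tendsto_id |>.const_sub 1
  have hev : ∀ᶠ t : ℝ in atTop, 1 / 2 ≤ 1 - s / t :=
    (hτ.eventually (lt_mem_nhds (by norm_num : (1 / 2 : ℝ) < 1))).mono fun t h => h.le
  rw [← integral_const_mul]
  refine Tendsto.congr' ((eventually_gt_atTop 0).mono fun t ht =>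
    (duhamelSlice_eq j h k x ht s).symm) ?_
  refine tendsto_integral_filter_of_dominated_convergence
    (fun y => 2 ^ (d + 1) * B * |w s y|) ?_ ?_ ((hw.integrable hs.le).abs.const_mul _)
    (ae_of_all _ fun y => Tendsto.mul_const _ (tendsto_kernelF j h k one_pos hτ ?_))
  · refine hev.mono fun t ht => AEStronglyMeasurable.mul (Continuous.aestronglyMeasurable ?_)
      (hw.meas s hs.le)
    have := continuous_kernelF j h k (show 0 < 1 - s / t by linarith)
    fun_prop
  · refine hev.mono fun t ht => ae_of_all _ fun y => ?_
    rw [norm_mul]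
    refine mul_le_mul_of_nonneg_right ((abs_kernelF_le hB (by linarith) _).trans ?_) (norm_nonneg _)
    exact mul_le_mul_of_nonneg_right (sqrt_inv_pow_le ht _) hB0
  · have : Tendsto (fun t : ℝ => (√t)⁻¹) atTop (𝓝 0) :=
      tendsto_inv_atTop_zero.comp Real.tendsto_sqrt_atTop
    simpa using (this.smul_const y).const_sub x

lemma intervalIntegrable_duhamelSlice_near (hw : IsDecayingSource A w) (hd : 2 ≤ d)
    (j h k : Fin d) (x : Sp d) {t : ℝ} (ht : 0 < t) :
    IntervalIntegrable (duhamelSlice j h k w x t) volume 0 (t / 2) := by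
  obtain ⟨B, hB0, hB⟩ := exists_kernelF_one_bounded j h k
  rw [intervalIntegrable_iff_integrableOn_Ioc_of_le (by linarith)]
  have hg : IntegrableOn (fun s : ℝ => 2 ^ (d + 1) * B *
      (A * weightMass d * (1 + s) ^ (-((d : ℝ) + 1) / 2))) (Set.Ioi 0) :=
    ((integrableOn_time_weight hd).const_mul (A * weightMass d)).const_mul _
  refine Integrable.mono' (hg.mono_set Set.Ioc_subset_Ioi_self) ?_ ?_
  · exact (aestronglyMeasurable_duhamelSlice hw j h k x t).mono_measure
      (Measure.restrict_mono (Set.Ioc_subset_Ioc_right (by linarith)) le_rfl)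
  · refine (ae_restrict_mem measurableSet_Ioc).mono fun s hs => ?_
    exact abs_duhamelSlice_near hw hB0 hB x hs.1 hs.2

lemma intervalIntegrable_singular {t : ℝ} :
    IntervalIntegrable (fun s : ℝ => (t - s) ^ (-(1 / 2) : ℝ)) volume (t / 2) t := by
  have := (intervalIntegral.intervalIntegrable_rpow' (a := t - t / 2) (b := t - t)
    (r := -(1 / 2)) (by norm_num)).comp_sub_left t
  simpa using this

lemma integral_singular {t : ℝ} (ht : 0 < t) :
    ∫ s in (t / 2)..t, (t - s) ^ (-(1 / 2) : ℝ) ≤ 2 * √t := by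
  rw [intervalIntegral.integral_comp_sub_left (fun s : ℝ => s ^ (-(1 / 2) : ℝ)) t, sub_self,
    integral_rpow (Or.inl (by norm_num))]
  rw [show (-(1 / 2) : ℝ) + 1 = 1 / 2 by norm_num, ← Real.sqrt_eq_rpow, ← Real.sqrt_eq_rpow,
    Real.sqrt_zero, sub_zero]
  have := Real.sqrt_le_sqrt (show t - t / 2 ≤ t by linarith)
  linarith

lemma ae_restrict_Ioc_lt (a t : ℝ) : ∀ᵐ s : ℝ, s ∈ Set.Ioc a t → s < t := by
  filter_upwards [Measure.ae_ne volume t] with s hs h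
  exact lt_of_le_of_ne h.2 hs

lemma intervalIntegrable_duhamelSlice_far (hw : IsDecayingSource A w)
    (j h k : Fin d) (x : Sp d) {t : ℝ} (ht : 0 < t) :
    IntervalIntegrable (duhamelSlice j h k w x t) volume (t / 2) t := by
  have hg := (intervalIntegrable_singular (t := t)).const_mul
    (A * (∫ z, |kernelF j h k 1 z|) * 2 ^ (d + 1) * (√t ^ (d + 1))⁻¹)
  rw [intervalIntegrable_iff_integrableOn_Ioc_of_le (by linarith)] at hg ⊢
  refine Integrable.mono' hg ?_ ?_
  · exact (aestronglyMeasurable_duhamelSlice hw j h k x t).mono_measure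
      (Measure.restrict_mono (Set.Ioc_subset_Ioc_left (by linarith)) le_rfl)
  · rw [ae_restrict_iff' measurableSet_Ioc]
    filter_upwards [ae_restrict_Ioc_lt (t / 2) t] with s h1 h2
    exact abs_duhamelSlice_far hw j h k x h2.1.le (h1 h2)

lemma tendsto_duhamel_near (hw : IsDecayingSource A w) (hd : 2 ≤ d) (j h k : Fin d) (x : Sp d) :
    Tendsto (fun t => ∫ s in (0 : ℝ)..(t / 2), duhamelSlice j h k w x t s) atTop
      (𝓝 (kernelF j h k 1 x * ∫ s in Set.Ioi (0 : ℝ), ∫ y, w s y)) := by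
  obtain ⟨B, hB0, hB⟩ := exists_kernelF_one_bounded j h k
  have e : ∀ᶠ t : ℝ in atTop, ∫ s in Set.Ioi (0 : ℝ),
      (Set.Ioc 0 (t / 2)).indicator (duhamelSlice j h k w x t) s =
      ∫ s in (0 : ℝ)..(t / 2), duhamelSlice j h k w x t s := by
    filter_upwards [eventually_gt_atTop 0] with t ht
    rw [intervalIntegral.integral_of_le (by linarith), setIntegral_indicator measurableSet_Ioc,
      Set.inter_eq_right.2 Set.Ioc_subset_Ioi_self]
  rw [← integral_const_mul]
  refine Tendsto.congr' e ?_
  refine tendsto_integral_filter_of_dominated_convergence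
    (fun s => 2 ^ (d + 1) * B * (A * weightMass d * (1 + s) ^ (-((d : ℝ) + 1) / 2))) ?_ ?_
    (((integrableOn_time_weight hd).const_mul (A * weightMass d)).const_mul _) ?_
  · filter_upwards [eventually_gt_atTop 0] with t ht
    have h1 := (intervalIntegrable_duhamelSlice_near hw hd j h k x ht)
    rw [intervalIntegrable_iff_integrableOn_Ioc_of_le (by linarith)] at h1
    exact ((integrable_indicator_iff measurableSet_Ioc).2 h1).aestronglyMeasurable.restrict
  · refine Eventually.of_forall fun t =>
      (ae_restrict_mem measurableSet_Ioi).mono fun s (hs : 0 < s) => ?_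
    by_cases hst : s ∈ Set.Ioc 0 (t / 2)
    · rw [Set.indicator_of_mem hst]
      exact abs_duhamelSlice_near hw hB0 hB x hs hst.2
    · rw [Set.indicator_of_notMem hst, norm_zero]
      have h0 : 0 ≤ ∫ y, |w s y| := integral_nonneg fun _ => abs_nonneg _
      have := h0.trans (hw.integral_abs_le hs.le)
      positivity
  · refine (ae_restrict_mem measurableSet_Ioi).mono fun s (hs : 0 < s) => ?_
    refine (tendsto_duhamelSlice hw j h k x hs).congr' ?_
    filter_upwards [eventually_ge_atTop (2 * s)] with t ht
    exact (Set.indicator_of_mem (show s ∈ Set.Ioc 0 (t / 2) from ⟨hs, by linarith⟩) _).symm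

/-- The times close to `t` do not contribute: the decay `(1+s)^{-(d+1)}` of the source outweighs the
factor `t^{(d+1)/2}` and the integrable singularity of the kernel. -/
lemma tendsto_duhamel_far (hw : IsDecayingSource A w) (hd : 2 ≤ d) (j h k : Fin d) (x : Sp d) :
    Tendsto (fun t => ∫ s in (t / 2)..t, duhamelSlice j h k w x t s) atTop (𝓝 0) := by
  set D := A * (∫ z, |kernelF j h k 1 z|) * 2 ^ (d + 1) with hD
  have hD0 : 0 ≤ D := by
    have hI : 0 ≤ ∫ z, |kernelF j h k 1 z| := integral_nonneg fun _ => abs_nonneg _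
    have := hw.nonneg
    positivity
  refine squeeze_zero_norm' (a := fun t => 2 * D * (√t ^ d)⁻¹) ?_ ?_
  · filter_upwards [eventually_gt_atTop 0] with t ht
    have hs := Real.sqrt_pos.2 ht
    refine (intervalIntegral.norm_integral_le_of_norm_le (by linarith) ?_
      ((intervalIntegrable_singular (t := t)).const_mul (D * (√t ^ (d + 1))⁻¹))).trans ?_
    · filter_upwards [ae_restrict_Ioc_lt (t / 2) t] with s h1 h2
      exact abs_duhamelSlice_far hw j h k x h2.1.le (h1 h2)
    · rw [intervalIntegral.integral_const_mul]
      calc _ ≤ D * (√t ^ (d + 1))⁻¹ * (2 * √t) := by gcongr; exact integral_singular ht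
        _ = _ := by rw [pow_succ]; field_simp
  · have : Tendsto (fun t : ℝ => (√t ^ d)⁻¹) atTop (𝓝 0) :=
      tendsto_inv_atTop_zero.comp ((tendsto_pow_atTop (by omega)).comp Real.tendsto_sqrt_atTop)
    simpa using this.const_mul (2 * D)

/-- At the parabolic scale, the Duhamel integral converges to the kernel at time `1`
times the total mass of the source. -/
lemma tendsto_duhamel (hw : IsDecayingSource A w) (hd : 2 ≤ d) (j h k : Fin d) (x : Sp d) :
    Tendsto (fun t => √t ^ (d + 1) *
        ∫ s in (0 : ℝ)..t, ∫ y, kernelF j h k (t - s) (√t • x - y) * w s y) atTop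
      (𝓝 (kernelF j h k 1 x * ∫ s in Set.Ioi (0 : ℝ), ∫ y, w s y)) := by
  have := (tendsto_duhamel_near hw hd j h k x).add (tendsto_duhamel_far hw hd j h k x)
  rw [add_zero] at this
  refine this.congr' ?_
  filter_upwards [eventually_gt_atTop 0] with t ht
  rw [intervalIntegral.integral_add_adjacent_intervals
    (intervalIntegrable_duhamelSlice_near hw hd j h k x ht)
    (intervalIntegrable_duhamelSlice_far hw j h k x ht), ← intervalIntegral.integral_const_mul]
  rfl

end Duhamel

/-! ### The velocity products as sources -/

section Velocity

variable {d : ℕ}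

/-- The decay of the velocity with a nonnegative constant and without the minimum. -/
def HasDecay (C : ℝ) (u : ℝ → Sp d → Sp d) : Prop :=
  0 ≤ C ∧ ∀ α β : ℝ, 0 ≤ α → 0 ≤ β → α + β ≤ (d : ℝ) + 1 → ∀ t : ℝ, 0 ≤ t →
    ∀ᵐ x : Sp d, ‖u t x‖ ≤ C * (1 + ‖x‖) ^ (-α) * (1 + t) ^ (-β / 2)

lemma SpaceTimeDecay.exists_hasDecay {ϑ : ℝ} (hϑ : (d : ℝ) + 1 < ϑ) {u : ℝ → Sp d → Sp d}
    (h : SpaceTimeDecay ϑ u) : ∃ C, HasDecay C u := by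
  obtain ⟨C, hC⟩ := h
  refine ⟨|C|, abs_nonneg C, fun α β hα hβ hαβ t ht => ?_⟩
  filter_upwards [hC α β hα hβ (hαβ.trans_eq (min_eq_right hϑ.le).symm) t ht] with x hx
  refine hx.trans ?_
  gcongr
  exact le_abs_self C

lemma ae_norm_le_wNorm (f : Sp d → Sp d) (hf : wNorm ⊤ 0 f ≠ ⊤) :
    ∀ᵐ x, ‖f x‖ ≤ (wNorm ⊤ 0 f).toReal := by
  have e : wNorm ⊤ 0 f = eLpNormEssSup f volume := by simp [wNorm]
  rw [e] at hf ⊢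
  filter_upwards [ae_le_eLpNormEssSup (f := f) (μ := volume)] with x hx
  rw [← toReal_enorm]
  exact ENNReal.toReal_mono hf hx

lemma abs_mul_coord_sub_le (v w : Sp d) (h k : Fin d) :
    |v h * v k - w h * w k| ≤ (‖v‖ + ‖w‖) * ‖v - w‖ := by
  have e : v h * v k - w h * w k = v h * (v - w) k + (v - w) h * w k := by
    simp only [PiLp.sub_apply]; ring
  rw [e]
  refine (abs_add_le _ _).trans ?_
  rw [abs_mul, abs_mul, add_mul, mul_comm ‖w‖]
  gcongr <;> exact abs_coord_le _ _

/-- For the bound in space and time, the decay of `u` is used with `α = β = (d+1)/2`: then `2α > d`,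
and `β > 1` because `d ≥ 2`. -/
lemma isDecayingSource {C : ℝ} {u : ℝ → Sp d → Sp d} (hu : MemCw 0 u)
    (hd : HasDecay C u) (h k : Fin d) :
    IsDecayingSource (C ^ 2) (fun s y => u s y h * u s y k) := by
  have hprod : ∀ s y, |u s y h * u s y k| ≤ ‖u s y‖ ^ 2 := fun s y => by
    rw [abs_mul, sq]; gcongr <;> exact abs_coord_le _ _
  have hd0 : (0 : ℝ) ≤ d := Nat.cast_nonneg d
  have hsq : ∀ (r p : ℝ), 0 ≤ r → ((1 + r) ^ p) ^ 2 = (1 + r) ^ (p * 2) := fun r p hr => by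
    rw [← Real.rpow_natCast, ← Real.rpow_mul (by linarith)]; norm_num
  have hcoord : ∀ s, 0 ≤ s → ∀ i, AEStronglyMeasurable (fun y => u s y i) volume := fun s hs i =>
    (EuclideanSpace.proj (𝕜 := ℝ) i).continuous.comp_aestronglyMeasurable (hu.mem s hs).1
  have hmeas : ∀ s, 0 ≤ s → AEStronglyMeasurable (fun y => u s y h * u s y k) volume :=
    fun s hs => (hcoord s hs h).mul (hcoord s hs k)
  refine ⟨hmeas, fun s hs => ?_, fun s hs => ?_, fun s hs => ?_⟩
  · filter_upwards [hd.2 (((d : ℝ) + 1) / 2) (((d : ℝ) + 1) / 2) (by linarith) (by linarith)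
      (by linarith) s hs] with y hy
    refine (hprod s y).trans ((pow_le_pow_left₀ (norm_nonneg _) hy 2).trans_eq ?_)
    rw [mul_pow, mul_pow, hsq _ _ (norm_nonneg y), hsq _ _ hs]
    ring_nf
  · filter_upwards [hd.2 0 ((d : ℝ) + 1) le_rfl (by linarith) (by linarith) s hs] with y hy
    refine (hprod s y).trans ((pow_le_pow_left₀ (norm_nonneg _) hy 2).trans_eq ?_)
    rw [mul_pow, mul_pow, hsq _ _ (norm_nonneg y), hsq _ _ hs]
    simp
  · have hcv := hu.cont s hs
    have hfin : ∀ᶠ s' in 𝓝 s, wNorm ⊤ 0 (u s' - u s) < ⊤ :=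
      hcv.eventually (gt_mem_nhds ENNReal.zero_lt_top)
    refine squeeze_zero' (g := fun s' => 2 * C * (wNorm ⊤ 0 (u s' - u s)).toReal * weightMass d)
      (Eventually.of_forall fun s' => integral_nonneg fun _ => abs_nonneg _) ?_ ?_
    · filter_upwards [hfin, lt_mem_nhds hs] with s' hf hs'
      have hdec : ∀ r, 0 < r → ∀ᵐ y, ‖u r y‖ ≤ C * (1 + ‖y‖) ^ (-((d : ℝ) + 1)) := fun r hr => by
        filter_upwards [hd.2 ((d : ℝ) + 1) 0 (by linarith) le_rfl (by linarith) r hr.le] with y hy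
        simpa using hy
      rw [weightMass, ← integral_const_mul]
      refine integral_mono_of_nonneg (ae_of_all _ fun _ => abs_nonneg _)
        ((integrable_weight d).const_mul _) ?_
      filter_upwards [ae_norm_le_wNorm _ hf.ne, hdec s hs, hdec s' hs'] with y h1 h2 h3
      refine (abs_mul_coord_sub_le _ _ h k).trans ?_
      calc _ ≤ (C * (1 + ‖y‖) ^ (-((d : ℝ) + 1)) + C * (1 + ‖y‖) ^ (-((d : ℝ) + 1))) *
            (wNorm ⊤ 0 (u s' - u s)).toReal := by
            refine mul_le_mul (add_le_add h3 h2) h1 (norm_nonneg _) ?_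
            exact add_nonneg ((norm_nonneg _).trans h2) ((norm_nonneg _).trans h2)
        _ = _ := by ring
    · have := (ENNReal.tendsto_toReal ENNReal.zero_ne_top).comp hcv
      simpa using (this.const_mul (2 * C)).mul_const (weightMass d)

end Velocity

/-! ### The heat evolution of a divergence-free field -/

section Heat

variable {d : ℕ}

lemma MemLinf.exists_bound {ϑ : ℝ} {a : Sp d → Sp d} (ha : MemLinf ϑ a) :
    ∃ C, 0 ≤ C ∧ ∀ᵐ x, ‖a x‖ ≤ C * (1 + ‖x‖) ^ (-ϑ) := by
  refine ⟨(wNorm ⊤ ϑ a).toReal, ENNReal.toReal_nonneg, ?_⟩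
  have h := ha.2
  have e : wNorm ⊤ ϑ a = eLpNormEssSup (fun x => (1 + ‖x‖) ^ ϑ • a x) volume := by simp [wNorm]
  rw [e] at h ⊢
  filter_upwards [ae_le_eLpNormEssSup (f := fun x => (1 + ‖x‖) ^ ϑ • a x) (μ := volume)] with x hx
  have h1 := ENNReal.toReal_mono h.ne hx
  have hx0 : 0 < 1 + ‖x‖ := by positivity
  rw [toReal_enorm, norm_smul, Real.norm_of_nonneg (by positivity)] at h1
  rw [Real.rpow_neg hx0.le, ← div_eq_mul_inv, le_div_iff₀ (by positivity), mul_comm]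
  exact h1

lemma MemLinf.integrable_moment {ϑ : ℝ} (hϑ : (d : ℝ) + 1 < ϑ) {a : Sp d → Sp d}
    (ha : MemLinf ϑ a) : Integrable fun y => (1 + ‖y‖) * ‖a y‖ := by
  obtain ⟨C, hC, hb⟩ := ha.exists_bound
  have hi : Integrable fun y : Sp d => (1 + ‖y‖) ^ (-(ϑ - 1)) :=
    integrable_one_add_norm (by rw [finrank_euclideanSpace_fin]; linarith)
  refine (hi.const_mul C).mono' (AEStronglyMeasurable.mul (by fun_prop) ha.1.norm) ?_
  filter_upwards [hb] with y hy
  have h0 : 0 < 1 + ‖y‖ := by positivity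
  rw [Real.norm_of_nonneg (by positivity), show -(ϑ - 1) = 1 + -ϑ by ring, Real.rpow_add h0,
    Real.rpow_one]
  calc _ ≤ (1 + ‖y‖) * (C * (1 + ‖y‖) ^ (-ϑ)) := by gcongr
    _ = _ := by ring

lemma MemLinf.integrable {ϑ : ℝ} (hϑ : (d : ℝ) + 1 < ϑ) {a : Sp d → Sp d}
    (ha : MemLinf ϑ a) : Integrable a := by
  refine (ha.integrable_moment hϑ).mono' ha.1 (ae_of_all _ fun y => ?_)
  nlinarith [mul_nonneg (norm_nonneg y) (norm_nonneg (a y))]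

/-- A divergence-free integrable field has mean zero: test against `x_j`, cut off at
larger and larger radii. -/
lemma DivFree.integral_eq_zero {a : Sp d → Sp d} (hdiv : DivFree a) (ha : Integrable a) :
    ∫ x, a x = 0 := by
  ext j
  let χ : ContDiffBump (0 : Sp d) := ⟨1, 2, one_pos, one_lt_two⟩
  -- The dilates `R ψ(x/R)` of `ψ` have differentials `(Dψ)(x/R)`, which are bounded uniformly in
  -- `R` and converge to the `j`-th coordinate `(Dψ)(0)`.
  set ψ : Sp d → ℝ := fun z => z j * χ z with hψ
  have hψc : ContDiff ℝ ((⊤ : ℕ∞) : WithTop ℕ∞) ψ :=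
    ContDiff.mul (EuclideanSpace.proj (𝕜 := ℝ) j).contDiff χ.contDiff
  have hψs : HasCompactSupport ψ := χ.hasCompactSupport.mul_left
  have hψd : Differentiable ℝ ψ := hψc.differentiable (by simp)
  have hDc : Continuous (fderiv ℝ ψ) := hψc.continuous_fderiv (by simp)
  obtain ⟨K, hK⟩ := (hψs.fderiv ℝ).exists_bound_of_continuous hDc
  have hD0 : fderiv ℝ ψ 0 = EuclideanSpace.proj (𝕜 := ℝ) j := by
    have e : ψ =ᶠ[𝓝 0] fun z => (EuclideanSpace.proj (𝕜 := ℝ) j) z := by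
      filter_upwards [χ.eventuallyEq_one] with z hz
      simp [hψ, hz]
    rw [e.fderiv_eq]
    exact ContinuousLinearMap.fderiv _
  have hzero : ∀ n : ℕ, ∫ x, fderiv ℝ ψ (((n : ℝ) + 1)⁻¹ • x) (a x) = 0 := fun n => by
    have hR : ((n : ℝ) + 1) ≠ 0 := by positivity
    have hder : ∀ x, HasFDerivAt (fun x => ((n : ℝ) + 1) * ψ (((n : ℝ) + 1)⁻¹ • x))
        (fderiv ℝ ψ (((n : ℝ) + 1)⁻¹ • x)) x := fun x => by
      have h1 := ((hψd _).hasFDerivAt.comp x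
        ((hasFDerivAt_id x).const_smul (((n : ℝ) + 1)⁻¹))).const_mul ((n : ℝ) + 1)
      refine h1.congr_fderiv ?_
      ext v
      simp [hR]
    rw [← hdiv (fun x => ((n : ℝ) + 1) * ψ (((n : ℝ) + 1)⁻¹ • x)) ⟨?_, ?_⟩]
    · congr 1; ext x
      rw [real_inner_comm, gradient, InnerProductSpace.toDual_symm_apply, (hder x).fderiv]
    · exact contDiff_const.mul (hψc.comp (contDiff_const_smul _))
    · exact (hψs.comp_smul (inv_ne_zero hR)).mul_left
  have hlim : Tendsto (fun n : ℕ => ∫ x, fderiv ℝ ψ (((n : ℝ) + 1)⁻¹ • x) (a x)) atTop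
      (𝓝 (∫ x, fderiv ℝ ψ 0 (a x))) := by
    refine tendsto_integral_of_dominated_convergence (fun x => K * ‖a x‖) (fun n => ?_)
      (ha.norm.const_mul K) (fun n => ae_of_all _ fun x => ?_) (ae_of_all _ fun x => ?_)
    · have : AEStronglyMeasurable (fun x : Sp d => fderiv ℝ ψ (((n : ℝ) + 1)⁻¹ • x)) volume :=
        Continuous.aestronglyMeasurable (by fun_prop)
      exact (ContinuousLinearMap.apply ℝ ℝ).flip.aestronglyMeasurable_comp₂ this ha.1
    · exact (ContinuousLinearMap.le_opNorm _ _).trans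
        (mul_le_mul_of_nonneg_right (hK _) (norm_nonneg _))
    · have h1 : Tendsto (fun n : ℕ => ((n : ℝ) + 1)⁻¹ • x) atTop (𝓝 0) := by
        have : Tendsto (fun n : ℕ => ((n : ℝ) + 1)⁻¹) atTop (𝓝 0) := by
          simpa using tendsto_one_div_add_atTop_nhds_zero_nat (𝕜 := ℝ)
        simpa using this.smul_const x
      have h2 := (hDc.tendsto 0).comp h1
      exact ((ContinuousLinearMap.apply ℝ ℝ (a x)).continuous.tendsto _).comp h2
  simp only [hzero] at hlim
  have h0 := tendsto_nhds_unique hlim tendsto_const_nhds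
  rw [hD0, ContinuousLinearMap.integral_comp_comm _ ha] at h0
  simpa using h0

/-- The Lipschitz bound that dominates the difference quotients of the heat kernel. -/
lemma lipschitzWith_gauss : LipschitzWith 1 fun z : Sp d => Real.exp (-‖z‖ ^ 2 / 4) := by
  have h1 : LipschitzWith 1 fun r : ℝ => Real.exp (-r ^ 2 / 4) := by
    have hd : ∀ r : ℝ, HasDerivAt (fun r : ℝ => Real.exp (-r ^ 2 / 4))
        (Real.exp (-r ^ 2 / 4) * (-(r / 2))) r := fun r => by
      have := (((hasDerivAt_id r).pow 2).neg.div_const 4).exp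
      refine this.congr_deriv ?_
      simp; ring_nf
    refine lipschitzWith_of_nnnorm_deriv_le (fun r => (hd r).differentiableAt) fun r => ?_
    rw [(hd r).deriv, ← NNReal.coe_le_coe, coe_nnnorm, NNReal.coe_one, norm_mul,
      Real.norm_of_nonneg (Real.exp_pos _).le, Real.norm_eq_abs, abs_neg]
    have h2 : |r / 2| ≤ Real.exp (r ^ 2 / 4) := by
      refine le_trans ?_ (Real.add_one_le_exp _)
      rw [abs_le]; constructor <;> nlinarith [sq_nonneg (r / 2 - 1), sq_nonneg (r / 2 + 1)]
    calc _ ≤ Real.exp (-r ^ 2 / 4) * Real.exp (r ^ 2 / 4) := by gcongr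
      _ = 1 := by rw [← Real.exp_add, neg_div, neg_add_cancel, Real.exp_zero]
  have h2 := h1.comp (lipschitzWith_one_norm (E := Sp d))
  rw [one_mul] at h2
  exact h2

lemma hasDerivAt_gauss_line (x y : Sp d) :
    HasDerivAt (fun r : ℝ => Real.exp (-‖x - r • y‖ ^ 2 / 4))
      (inner ℝ x y / 2 * Real.exp (-‖x‖ ^ 2 / 4)) 0 := by
  have h1 : ∀ r : ℝ, ‖x - r • y‖ ^ 2 = ‖x‖ ^ 2 - 2 * (r * inner ℝ x y) + r ^ 2 * ‖y‖ ^ 2 :=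
    fun r => by
      rw [norm_sub_sq_real, real_inner_smul_right, norm_smul, mul_pow, Real.norm_eq_abs, sq_abs]
  have h2 : HasDerivAt (fun r : ℝ =>
      -(‖x‖ ^ 2 - 2 * (r * inner ℝ x y) + r ^ 2 * ‖y‖ ^ 2) / 4) (inner ℝ x y / 2) 0 := by
    have := ((((((hasDerivAt_id (0 : ℝ)).mul_const (inner ℝ x y)).const_mul 2).const_sub
      (‖x‖ ^ 2)).add (((hasDerivAt_id (0 : ℝ)).pow 2).mul_const (‖y‖ ^ 2))).neg.div_const 4)
    refine this.congr_deriv ?_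
    simp; ring
  simp only [h1]
  refine h2.exp.congr_deriv ?_
  simp; ring

/-- The heat evolution of a mean zero field, in parabolic units. -/
lemma heat_parabolic {a : Sp d → Sp d} (ha : Integrable a) (h0 : ∫ y, a y = 0) {t : ℝ}
    (ht : 0 < t) (x : Sp d) :
    √t ^ (d + 1) • heat a t (√t • x) = (4 * Real.pi) ^ (-(d : ℝ) / 2) •
      ∫ y, (√t * (Real.exp (-‖x - (√t)⁻¹ • y‖ ^ 2 / 4) - Real.exp (-‖x‖ ^ 2 / 4))) • a y := by
  have hs := Real.sqrt_pos.2 ht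
  have e1 : ∀ y, Real.exp (-‖√t • x - y‖ ^ 2 / (4 * t)) = Real.exp (-‖x - (√t)⁻¹ • y‖ ^ 2 / 4) := by
    intro y
    have : √t • x - y = √t • (x - (√t)⁻¹ • y) := by rw [smul_sub, smul_inv_smul₀ hs.ne']
    rw [this, norm_smul, mul_pow, Real.norm_of_nonneg hs.le, Real.sq_sqrt ht.le]
    congr 1
    field_simp
  have hi : Integrable fun y => Real.exp (-‖x - (√t)⁻¹ • y‖ ^ 2 / 4) • a y := by
    have hc : Continuous fun y : Sp d => Real.exp (-‖x - (√t)⁻¹ • y‖ ^ 2 / 4) := by fun_prop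
    refine ha.bdd_smul 1 hc.aestronglyMeasurable (ae_of_all _ fun y => ?_)
    rw [Real.norm_of_nonneg (Real.exp_pos _).le, Real.exp_le_one_iff]
    have := sq_nonneg ‖x - (√t)⁻¹ • y‖
    linarith
  have hi' : Integrable fun y => Real.exp (-‖x‖ ^ 2 / 4) • a y := ha.smul (Real.exp (-‖x‖ ^ 2 / 4))
  have e2 : ∫ y, (√t * (Real.exp (-‖x - (√t)⁻¹ • y‖ ^ 2 / 4) - Real.exp (-‖x‖ ^ 2 / 4))) • a y =
      √t • ∫ y, Real.exp (-‖x - (√t)⁻¹ • y‖ ^ 2 / 4) • a y := by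
    simp only [mul_smul, sub_smul]
    rw [integral_smul, integral_sub hi hi', integral_smul, h0, smul_zero, sub_zero]
  unfold heat
  simp only [e1]
  rw [e2, smul_smul, smul_smul]
  congr 1
  rw [Real.mul_rpow (by positivity) ht.le]
  have : t ^ (-(d : ℝ) / 2) = (√t ^ d)⁻¹ := by
    rw [neg_div, Real.rpow_neg ht.le, Real.sqrt_eq_rpow, ← Real.rpow_natCast, ← Real.rpow_mul ht.le]
    ring_nf
  rw [this, pow_succ]
  field_simp

/-- At the parabolic scale, the heat evolution of a mean zero field converges to
its first moment paired with the gradient of the Gaussian. -/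
lemma tendsto_heat {a : Sp d → Sp d} (ha : Integrable a) (h0 : ∫ y, a y = 0)
    (h1 : Integrable fun y => (1 + ‖y‖) * ‖a y‖) (x : Sp d) :
    Tendsto (fun t => √t ^ (d + 1) • heat a t (√t • x)) atTop
      (𝓝 ((4 * Real.pi) ^ (-(d : ℝ) / 2) •
        ∫ y, (inner ℝ x y / 2 * Real.exp (-‖x‖ ^ 2 / 4)) • a y)) := by
  refine Tendsto.congr' ((eventually_gt_atTop 0).mono fun t ht => (heat_parabolic ha h0 ht x).symm)
    (Tendsto.const_smul ?_ _)
  refine tendsto_integral_filter_of_dominated_convergence (fun y => (1 + ‖y‖) * ‖a y‖) ?_ ?_ h1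
    (ae_of_all _ fun y => Tendsto.smul_const ?_ _)
  · refine Eventually.of_forall fun t => ?_
    have hc : Continuous fun y : Sp d =>
        √t * (Real.exp (-‖x - (√t)⁻¹ • y‖ ^ 2 / 4) - Real.exp (-‖x‖ ^ 2 / 4)) := by fun_prop
    exact hc.aestronglyMeasurable.smul ha.1
  · filter_upwards [eventually_gt_atTop 0] with t ht
    refine ae_of_all _ fun y => ?_
    have hs := Real.sqrt_pos.2 ht
    rw [norm_smul]
    refine mul_le_mul_of_nonneg_right ?_ (norm_nonneg _)
    have := lipschitzWith_gauss.dist_le_mul (x - (√t)⁻¹ • y) x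
    rw [dist_eq_norm, dist_eq_norm, NNReal.coe_one, one_mul, sub_sub_cancel_left, norm_neg,
      norm_smul, Real.norm_of_nonneg (inv_nonneg.2 hs.le)] at this
    rw [norm_mul, Real.norm_of_nonneg hs.le]
    calc _ ≤ √t * ((√t)⁻¹ * ‖y‖) := by gcongr
      _ = ‖y‖ := mul_inv_cancel_left₀ hs.ne' _
      _ ≤ 1 + ‖y‖ := by linarith
  · have h2 := (hasDerivAt_iff_tendsto_slope_zero.1 (hasDerivAt_gauss_line x y))
    have h3 : Tendsto (fun t : ℝ => (√t)⁻¹) atTop (𝓝[≠] 0) := by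
      refine tendsto_nhdsWithin_iff.2 ⟨tendsto_inv_atTop_zero.comp Real.tendsto_sqrt_atTop, ?_⟩
      filter_upwards [eventually_gt_atTop 0] with t ht
      exact inv_ne_zero (Real.sqrt_pos.2 ht).ne'
    refine (h2.comp h3).congr fun t => ?_
    simp

end Heat

/-! ### The asymptotic profile -/

section Profile

variable {d : ℕ}

/-- The first moments `∫ y_k a_j(y) dy`. -/
noncomputable def firstMoment (a : Sp d → Sp d) (k j : Fin d) : ℝ := ∫ y, y k * a y j

/-- The limit `U` of `t^{(d+1)/2} u(√t x, t)`: the heat flow sees only the first moments of the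
datum, and the nonlinearity only the total energy matrix `K`. -/
noncomputable def profile (a : Sp d → Sp d) (K : Fin d → Fin d → ℝ) (x : Sp d) : Sp d :=
  ((4 * Real.pi) ^ (-(d : ℝ) / 2) • ∫ y, (inner ℝ x y / 2 * Real.exp (-‖x‖ ^ 2 / 4)) • a y) -
    WithLp.toLp 2 fun j => ∑ h : Fin d, ∑ k : Fin d, kernelF j h k 1 x * K h k

/-- The symbol of the `j`-th component of the profile, up to a constant and a Gaussian factor. -/
noncomputable def profileSymb (m K : Fin d → Fin d → ℝ) (j : Fin d) (ξ : Sp d) : ℝ :=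
  (∑ h : Fin d, ∑ k : Fin d, K h k * symb j h k ξ) + ∑ k : Fin d, m k j * ξ k

/-- The Fourier transform of the profile component `j`, up to a constant: `profileSymb` times a
Gaussian. -/
noncomputable def profileAmp (m K : Fin d → Fin d → ℝ) (j : Fin d) (ξ : Sp d) : ℝ :=
  Real.exp (-‖ξ‖ ^ 2) * profileSymb m K j ξ

lemma profileAmp_eq (m K : Fin d → Fin d → ℝ) (j : Fin d) (ξ : Sp d) :
    profileAmp m K j ξ =
      (∑ h : Fin d, ∑ k : Fin d, K h k * (Real.exp (-‖ξ‖ ^ 2) * symb j h k ξ)) +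
        ∑ k : Fin d, m k j * (ξ k * Real.exp (-‖ξ‖ ^ 2)) := by
  unfold profileAmp profileSymb
  rw [mul_add, Finset.mul_sum, Finset.mul_sum]
  congr 1
  · refine Finset.sum_congr rfl fun h _ => ?_
    rw [Finset.mul_sum]
    exact Finset.sum_congr rfl fun k _ => by ring
  · exact Finset.sum_congr rfl fun k _ => by ring

lemma integrable_profileAmp_aux (m K : Fin d → Fin d → ℝ) (j : Fin d) :
    (∀ h, Integrable fun ξ : Sp d =>
      ∑ k : Fin d, K h k * (Real.exp (-‖ξ‖ ^ 2) * symb j h k ξ)) ∧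
    (Integrable fun ξ : Sp d =>
      ∑ h : Fin d, ∑ k : Fin d, K h k * (Real.exp (-‖ξ‖ ^ 2) * symb j h k ξ)) ∧
    Integrable fun ξ : Sp d => ∑ k : Fin d, m k j * (ξ k * Real.exp (-‖ξ‖ ^ 2)) := by
  have h1 : ∀ h, Integrable fun ξ : Sp d =>
      ∑ k : Fin d, K h k * (Real.exp (-‖ξ‖ ^ 2) * symb j h k ξ) := fun h =>
    integrable_finsetSum _ fun k _ => (integrable_gauss_mul_symb j h k).const_mul _
  exact ⟨h1, integrable_finsetSum _ fun h _ => h1 h,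
    integrable_finsetSum _ fun k _ => (integrable_gauss₁ k).const_mul _⟩

lemma integrable_profileAmp (m K : Fin d → Fin d → ℝ) (j : Fin d) :
    Integrable (profileAmp m K j) := by
  obtain ⟨-, h2, h3⟩ := integrable_profileAmp_aux m K j
  exact (h2.add h3).congr (ae_of_all _ fun ξ => (profileAmp_eq m K j ξ).symm)

lemma oscInt_profileAmp (m K : Fin d → Fin d → ℝ) (j : Fin d) (x : Sp d) :
    oscInt (profileAmp m K j) x =
      (∑ h : Fin d, ∑ k : Fin d, (K h k : ℂ) *
        oscInt (fun ξ => Real.exp (-‖ξ‖ ^ 2) * symb j h k ξ) x) +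
      ∑ k : Fin d, (m k j : ℂ) * oscInt (fun ξ => ξ k * Real.exp (-‖ξ‖ ^ 2)) x := by
  obtain ⟨h1, h2, h3⟩ := integrable_profileAmp_aux m K j
  rw [show profileAmp m K j = _ from funext (profileAmp_eq m K j), oscInt_add h2 h3,
    oscInt_sum _ fun h _ => h1 h, oscInt_sum _ fun k _ => (integrable_gauss₁ k).const_mul _]
  simp only [oscInt_const_mul]
  congr 1
  refine Finset.sum_congr rfl fun h _ => ?_
  rw [oscInt_sum _ fun k _ => (integrable_gauss_mul_symb j h k).const_mul _]
  simp only [oscInt_const_mul]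

/-- The normalizing constant of the heat kernel at time `1`, in terms of that of the Fourier
transform of the Gaussian. -/
lemma heat_constant : (4 * Real.pi) ^ (-(d : ℝ) / 2) =
    ((2 * Real.pi) ^ d)⁻¹ * Real.pi ^ ((d : ℝ) / 2) := by
  have hπ := Real.pi_pos
  have h4 : (4 : ℝ) ^ (-(d : ℝ) / 2) = (2 ^ d)⁻¹ := by
    rw [show (4 : ℝ) = 2 ^ (2 : ℝ) by norm_num, ← Real.rpow_mul (by norm_num), ← Real.rpow_natCast,
      ← Real.rpow_neg (by norm_num)]
    congr 1; ring
  have hp : Real.pi ^ (-(d : ℝ) / 2) = (Real.pi ^ d)⁻¹ * Real.pi ^ ((d : ℝ) / 2) := by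
    rw [← Real.rpow_natCast, ← Real.rpow_neg hπ.le, ← Real.rpow_add hπ]
    congr 1; ring
  rw [Real.mul_rpow (by norm_num) hπ.le, h4, hp, mul_pow, mul_inv, mul_assoc]

lemma inner_eq_sum (x y : Sp d) : (inner ℝ x y : ℝ) = ∑ k : Fin d, x k * y k := by
  rw [PiLp.inner_apply]
  exact Finset.sum_congr rfl fun k _ => by simp [mul_comm]

lemma integrable_coord_mul {a : Sp d → Sp d} (ha : AEStronglyMeasurable a volume)
    (h1 : Integrable fun y => (1 + ‖y‖) * ‖a y‖) (k j : Fin d) :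
    Integrable fun y => y k * a y j := by
  have hj : AEStronglyMeasurable (fun y => a y j) volume :=
    (EuclideanSpace.proj (𝕜 := ℝ) j).continuous.comp_aestronglyMeasurable ha
  refine h1.mono' (AEStronglyMeasurable.mul (by fun_prop) hj) (ae_of_all _ fun y => ?_)
  rw [norm_mul]
  have := abs_coord_le y k
  have h2 := abs_coord_le (a y) j
  rw [← Real.norm_eq_abs] at this h2
  gcongr
  linarith

lemma heat_profile_apply {a : Sp d → Sp d} (ha : Integrable a)
    (h1 : Integrable fun y => (1 + ‖y‖) * ‖a y‖) (x : Sp d) (j : Fin d) :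
    (∫ y, (inner ℝ x y / 2 * Real.exp (-‖x‖ ^ 2 / 4)) • a y) j =
      Real.exp (-‖x‖ ^ 2 / 4) / 2 * ∑ k : Fin d, x k * firstMoment a k j := by
  have hi : Integrable fun y => (inner ℝ x y / 2 * Real.exp (-‖x‖ ^ 2 / 4)) • a y := by
    have hc : Continuous fun y : Sp d => inner ℝ x y / 2 * Real.exp (-‖x‖ ^ 2 / 4) := by fun_prop
    refine (h1.const_mul (‖x‖ * Real.exp (-‖x‖ ^ 2 / 4))).mono'
      (hc.aestronglyMeasurable.smul ha.1) (ae_of_all _ fun y => ?_)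
    rw [norm_smul, norm_mul, norm_div, Real.norm_of_nonneg (Real.exp_pos _).le, RCLike.norm_two]
    have h2 := norm_inner_le_norm (𝕜 := ℝ) x y
    have h3 : ‖(inner ℝ x y : ℝ)‖ / 2 ≤ ‖x‖ * (1 + ‖y‖) := by
      nlinarith [norm_nonneg (inner ℝ x y : ℝ), norm_nonneg x]
    calc _ ≤ ‖x‖ * (1 + ‖y‖) * Real.exp (-‖x‖ ^ 2 / 4) * ‖a y‖ := by gcongr
      _ = _ := by ring
  have h2 := ContinuousLinearMap.integral_comp_comm (EuclideanSpace.proj (𝕜 := ℝ) j) hi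
  simp only [EuclideanSpace.coe_proj] at h2
  rw [← h2]
  simp only [firstMoment]
  rw [Finset.mul_sum]
  simp only [← integral_const_mul]
  rw [← integral_finsetSum _ fun k _ =>
    ((integrable_coord_mul ha.1 h1 k j).const_mul _).const_mul _]
  congr 1; ext y
  rw [PiLp.smul_apply, smul_eq_mul, inner_eq_sum, Finset.sum_div, Finset.sum_mul, Finset.sum_mul]
  exact Finset.sum_congr rfl fun k _ => by ring

/-- The profile as an inverse Fourier transform. -/
lemma profile_apply {a : Sp d → Sp d} (ha : Integrable a)
    (h1 : Integrable fun y => (1 + ‖y‖) * ‖a y‖) (K : Fin d → Fin d → ℝ) (x : Sp d) (j : Fin d) :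
    profile a K x j = -((2 * Real.pi) ^ d)⁻¹ *
      (Complex.I * oscInt (profileAmp (firstMoment a) K j) x).re := by
  unfold profile
  have e1 : (Complex.I * ∑ k : Fin d, (firstMoment a k j : ℂ) *
      oscInt (fun ξ => ξ k * Real.exp (-‖ξ‖ ^ 2)) x).re =
        -(gaussHat x / 2 * ∑ k : Fin d, x k * firstMoment a k j) := by
    rw [Finset.mul_sum, Complex.re_sum, Finset.mul_sum, ← Finset.sum_neg_distrib]
    refine Finset.sum_congr rfl fun k _ => ?_
    rw [oscInt_gauss₁, show ∀ z w : ℂ, Complex.I * (z * (Complex.I * w)) = -(z * w) from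
      fun z w => by linear_combination z * w * Complex.I_mul_I, ← Complex.ofReal_mul,
      ← Complex.ofReal_neg, Complex.ofReal_re]
    ring
  have e2 : (Complex.I * ∑ h : Fin d, ∑ k : Fin d, (K h k : ℂ) *
      oscInt (fun ξ => Real.exp (-‖ξ‖ ^ 2) * symb j h k ξ) x).re =
        (2 * Real.pi) ^ d * ∑ h : Fin d, ∑ k : Fin d, kernelF j h k 1 x * K h k := by
    rw [Finset.mul_sum, Complex.re_sum, Finset.mul_sum]
    refine Finset.sum_congr rfl fun h _ => ?_
    rw [Finset.mul_sum, Complex.re_sum, Finset.mul_sum]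
    refine Finset.sum_congr rfl fun k _ => ?_
    rw [kernelF_eq, mul_left_comm, Complex.re_ofReal_mul]
    simp only [one_mul]
    have : (2 * Real.pi) ^ d ≠ 0 := by positivity
    field_simp
  rw [PiLp.sub_apply, PiLp.smul_apply, heat_profile_apply ha h1, oscInt_profileAmp, mul_add,
    Complex.add_re, e1, e2, heat_constant, gaussHat, smul_eq_mul]
  have : (2 * Real.pi) ^ d ≠ 0 := by positivity
  field_simp
  ring

lemma continuous_profile {a : Sp d → Sp d} (ha : Integrable a)
    (h1 : Integrable fun y => (1 + ‖y‖) * ‖a y‖) (K : Fin d → Fin d → ℝ) :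
    Continuous (profile a K) := by
  have hc : ∀ j, Continuous fun x => profile a K x j := fun j => by
    have := continuous_oscInt (integrable_profileAmp (firstMoment a) K j)
    simp only [profile_apply ha h1 K]
    fun_prop
  have e : profile a K = fun x => WithLp.toLp 2 fun j => profile a K x j := by ext x j; rfl
  rw [e]
  exact (PiLp.continuous_toLp 2 _).comp (continuous_pi hc)

/-- If the profile symbol vanishes, every vector is an eigenvector of `K + mᵀ`, so that this matrix
is a multiple of the identity, and then so is `K`. -/
lemma eq_smul_kron_of_profileSymb_eq_zero {m K : Fin d → Fin d → ℝ}
    (hsym : ∀ h k, K h k = K k h)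
    (h0 : ∀ ξ : Sp d, ξ ≠ 0 → ∀ j, profileSymb m K j ξ = 0) :
    ∃ κ, ∀ h k, K h k = κ * kron h k := by
  -- By symmetry of `K`, the vanishing of the symbol reads `|ξ|² (K + mᵀ) ξ = (ξ · K ξ) ξ`.
  have key : ∀ ξ : Sp d, ξ ≠ 0 → ∀ j, (∑ k : Fin d, (K j k + m k j) * ξ k) * ‖ξ‖ ^ 2 =
      ξ j * ∑ h : Fin d, ∑ k : Fin d, K h k * (ξ h * ξ k) := fun ξ hξ j => by
    have hn : ‖ξ‖ ^ 2 ≠ 0 := pow_ne_zero _ (norm_ne_zero_iff.2 hξ)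
    have e : ∑ h : Fin d, ∑ k : Fin d, K h k * symb j h k ξ = ∑ k : Fin d, K j k * ξ k -
        ξ j * (∑ h : Fin d, ∑ k : Fin d, K h k * (ξ h * ξ k)) / ‖ξ‖ ^ 2 := by
      have e1 : ∀ h k, K h k * symb j h k ξ = K h k * ξ h * kron j k / 2 +
          K h k * ξ k * kron j h / 2 - ξ j * (K h k * (ξ h * ξ k)) / ‖ξ‖ ^ 2 := fun h k => by
        unfold symb; ring
      simp only [e1, Finset.sum_sub_distrib, Finset.sum_add_distrib, ← Finset.sum_div,
        ← Finset.mul_sum]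
      congr 1
      have e2 : ∑ h : Fin d, ∑ k : Fin d, K h k * ξ h * kron j k = ∑ k : Fin d, K j k * ξ k := by
        simp only [kron, mul_ite, mul_one, mul_zero, Finset.sum_ite_eq, Finset.mem_univ, if_true]
        exact Finset.sum_congr rfl fun k _ => by rw [hsym]
      have e3 : ∑ h : Fin d, ∑ k : Fin d, K h k * ξ k * kron j h = ∑ k : Fin d, K j k * ξ k := by
        rw [Finset.sum_comm]
        simp only [kron, mul_ite, mul_one, mul_zero, Finset.sum_ite_eq, Finset.mem_univ, if_true]
      rw [e2, e3]; ring
    have h1 := h0 ξ hξ j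
    unfold profileSymb at h1
    rw [e] at h1
    simp only [add_mul, Finset.sum_add_distrib]
    have h2 := congrArg (· * ‖ξ‖ ^ 2) h1
    simp only [add_mul, sub_mul, div_mul_cancel₀ _ hn, zero_mul] at h2
    linarith
  have hne : ∀ i : Fin d, (EuclideanSpace.single i (1 : ℝ) : Sp d) ≠ 0 := fun i h => by
    simpa using congrArg (fun v : Sp d => v i) h
  -- The choice `ξ = e_i` shows that `K + mᵀ` is diagonal with the diagonal of `K`.
  have hdiag : ∀ i j : Fin d, K j i + m i j = kron j i * K i i := fun i j => by
    have := key _ (hne i) j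
    simpa [kron, Pi.single_apply, PiLp.norm_single, Finset.sum_ite_eq] using this
  -- The choice `ξ = e_i + e_l` relates two diagonal entries of `K` to the entry off the diagonal.
  have hpair : ∀ i l : Fin d, i ≠ l → K i i * 2 = K i i + K i l + (K l i + K l l) :=
      fun i l hil => by
    set ξ : Sp d := EuclideanSpace.single i (1 : ℝ) + EuclideanSpace.single l (1 : ℝ) with hξ
    have hc : ∀ k, ξ k = kron k i + kron k l := fun k => by
      simp [hξ, kron]
    have hξi : ξ i = 1 := by rw [hc]; simp [kron, hil]
    have hξ0 : ξ ≠ 0 := fun h => by rw [h] at hξi; simp at hξi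
    have hn : ‖ξ‖ ^ 2 = 2 := by
      rw [hξ, norm_add_sq_real, inner_single_right', PiLp.norm_single, PiLp.norm_single]
      simp [hil]; norm_num
    have := key ξ hξ0 i
    rw [hn, hξi] at this
    simp only [hc, hdiag] at this
    have e1 : ∀ f : Fin d → ℝ, ∑ k : Fin d, f k * (kron k i + kron k l) = f i + f l := fun f => by
      simp [kron, mul_add, Finset.sum_add_distrib]
    have e2 : ∀ h, ∑ k : Fin d, K h k * ((kron h i + kron h l) * (kron k i + kron k l)) =
        (K h i + K h l) * (kron h i + kron h l) := fun h => by
      rw [← e1 (K h), Finset.sum_mul]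
      exact Finset.sum_congr rfl fun k _ => by ring
    simp only [e1, e2] at this
    simp [kron, hil] at this
    linarith
  rcases isEmpty_or_nonempty (Fin d) with hd | ⟨⟨i₀⟩⟩
  · exact ⟨0, fun h => hd.elim h⟩
  refine ⟨K i₀ i₀, fun h k => ?_⟩
  have heq : ∀ i l : Fin d, i ≠ l → K i l = 0 ∧ K i i = K l l := fun i l hil => by
    have h1 := hpair i l hil
    have h2 := hpair l i hil.symm
    have h3 := hsym i l
    constructor <;> linarith
  by_cases hk : h = k
  · subst hk
    by_cases hi : h = i₀
    · simp [kron, hi]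
    · simp [kron, (heq h i₀ hi).2]
  · simp [kron, hk, (heq h k hk).1]

/-- The profile vanishes identically only if the energy matrix is a multiple of the identity. -/
lemma exists_profile_ne_zero {a : Sp d → Sp d} (ha : Integrable a)
    (h1 : Integrable fun y => (1 + ‖y‖) * ‖a y‖) {K : Fin d → Fin d → ℝ}
    (hsym : ∀ h k, K h k = K k h) (hK : ¬ ∃ κ, ∀ h k, K h k = κ * kron h k) :
    ∃ x, profile a K x ≠ 0 := by
  by_contra! hU
  refine hK (eq_smul_kron_of_profileSymb_eq_zero (m := firstMoment a) hsym fun ξ hξ j => ?_)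
  have hcont : ContinuousAt (profileAmp (firstMoment a) K j) ξ := by
    unfold profileAmp profileSymb
    have : ∀ h k, ContinuousAt (symb j h k) ξ := fun h k => continuousAt_symb j h k hξ
    fun_prop
  have hodd : ∀ ξ, profileAmp (firstMoment a) K j (-ξ) = -profileAmp (firstMoment a) K j ξ :=
    fun ξ => by
      simp only [profileAmp, profileSymb, symb_neg, norm_neg, PiLp.neg_apply, mul_neg,
        Finset.sum_neg_distrib]
      ring
  have hosc : ∀ x, oscInt (profileAmp (firstMoment a) K j) x = 0 := fun x => by
    have h2 := profile_apply ha h1 K x j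
    rw [hU x, PiLp.zero_apply, eq_comm, mul_eq_zero] at h2
    have h3 := h2.resolve_left (neg_ne_zero.2 (by positivity))
    have h4 := oscInt_odd_real hodd x
    rw [h3, Complex.ofReal_zero, eq_comm, mul_eq_zero] at h4
    exact h4.resolve_left Complex.I_ne_zero
  have := eq_zero_of_oscInt_eq_zero (integrable_profileAmp _ K j) hosc hcont
  exact (mul_eq_zero.1 this).resolve_left (Real.exp_pos _).ne'

end Profile

/-! ### The limit of the potential -/

section Potential

variable {d : ℕ}

/-- The basic potentials, whose combination with the energy matrix is `Π / γ_d`. -/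
noncomputable def basicPotential (h k : Fin d) (x : Sp d) : ℝ :=
  kron h k / ((d : ℝ) * ‖x‖ ^ d) - x h * x k / ‖x‖ ^ (d + 2)

lemma differentiableAt_basicPotential (hd : 2 ≤ d) (h k : Fin d) {x : Sp d} (hx : x ≠ 0) :
    DifferentiableAt ℝ (basicPotential h k) x := by
  have hn : DifferentiableAt ℝ (fun x : Sp d => ‖x‖) x :=
    (contDiffAt_norm ℝ hx (n := 1)).differentiableAt (by simp)
  have h0 : ‖x‖ ≠ 0 := norm_ne_zero_iff.2 hx
  have hd0 : (d : ℝ) ≠ 0 := by positivity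
  unfold basicPotential
  simp only [div_eq_mul_inv]
  fun_prop (disch := positivity)

/-- The trace of the basic potentials vanishes. -/
lemma sum_basicPotential (hd : 2 ≤ d) {x : Sp d} (hx : x ≠ 0) :
    ∑ h : Fin d, basicPotential h h x = 0 := by
  have h0 : ‖x‖ ≠ 0 := norm_ne_zero_iff.2 hx
  have hd0 : (d : ℝ) ≠ 0 := by positivity
  unfold basicPotential
  rw [Finset.sum_sub_distrib, ← Finset.sum_div, ← Finset.sum_div]
  have : ∑ h : Fin d, x h * x h = ‖x‖ ^ 2 := by
    rw [← inner_eq_sum, real_inner_self_eq_norm_sq]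
  rw [this]
  simp only [kron, if_true, Finset.sum_const, Finset.card_univ, Fintype.card_fin, nsmul_eq_mul]
  field_simp
  ring

lemma hasFDerivAt_potential (hd : 2 ≤ d) (u : ℝ → Sp d → Sp d) (t : ℝ) {x : Sp d} (hx : x ≠ 0) :
    HasFDerivAt (potential u t)
      (gammaD d • ∑ h : Fin d, ∑ k : Fin d,
        energyK u h k t • fderiv ℝ (basicPotential h k) x) x := by
  unfold potential
  refine HasFDerivAt.const_mul (HasFDerivAt.fun_sum fun h _ => HasFDerivAt.fun_sum fun k _ => ?_) _
  exact (differentiableAt_basicPotential hd h k hx).hasFDerivAt.mul_const _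

lemma tendsto_gradient_potential (hd : 2 ≤ d) {u : ℝ → Sp d → Sp d} {K : Fin d → Fin d → ℝ}
    (hK : ∀ h k, Tendsto (energyK u h k) atTop (𝓝 (K h k))) {x : Sp d} (hx : x ≠ 0) :
    Tendsto (fun t => gradient (potential u t) x) atTop
      (𝓝 ((InnerProductSpace.toDual ℝ (Sp d)).symm (gammaD d • ∑ h : Fin d, ∑ k : Fin d,
        K h k • fderiv ℝ (basicPotential h k) x))) := by
  have e : ∀ t, gradient (potential u t) x = (InnerProductSpace.toDual ℝ (Sp d)).symm
      (gammaD d • ∑ h : Fin d, ∑ k : Fin d, energyK u h k t • fderiv ℝ (basicPotential h k) x) :=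
    fun t => by rw [gradient, (hasFDerivAt_potential hd u t hx).fderiv]
  simp only [e]
  refine ((InnerProductSpace.toDual ℝ (Sp d)).symm.continuous.tendsto _).comp
    (Tendsto.const_smul (tendsto_finsetSum _ fun h _ => tendsto_finsetSum _ fun k _ => ?_) _)
  exact (hK h k).smul_const _

lemma sum_fderiv_basicPotential_eq_zero (hd : 2 ≤ d) (κ : ℝ) {x : Sp d} (hx : x ≠ 0) :
    ∑ h : Fin d, ∑ k : Fin d, (κ * kron h k) • fderiv ℝ (basicPotential h k) x = 0 := by
  have e1 : ∀ h : Fin d, ∑ k : Fin d, (κ * kron h k) • fderiv ℝ (basicPotential h k) x =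
      κ • fderiv ℝ (basicPotential h h) x := fun h => by
    simp [kron, ite_smul, mul_ite]
  have e2 : (fun y => ∑ h : Fin d, basicPotential h h y) =ᶠ[𝓝 x] fun _ => 0 := by
    filter_upwards [isOpen_ne.mem_nhds hx] with y hy
    exact sum_basicPotential hd hy
  have e3 := (HasFDerivAt.fun_sum (u := Finset.univ) fun h (_ : h ∈ Finset.univ) =>
    (differentiableAt_basicPotential hd h h hx).hasFDerivAt).fderiv
  rw [e2.fderiv_eq] at e3
  simp only [e1, ← Finset.smul_sum]
  rw [← e3]
  simp

end Potential

/-! ### Convergence to the profile and lower bounds -/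

section LowerBound

variable {d : ℕ}

/-- The right-hand side of the Duhamel formula. -/
noncomputable def duhamelRhs (a : Sp d → Sp d) (u : ℝ → Sp d → Sp d) (t : ℝ) (z : Sp d) : Sp d :=
  heat a t z - WithLp.toLp 2 fun j => ∑ h : Fin d, ∑ k : Fin d,
    ∫ s in (0 : ℝ)..t, ∫ y, kernelF j h k (t - s) (z - y) * (u s y h * u s y k)

/-- The limit of the energy matrix. -/
noncomputable def totalEnergy (u : ℝ → Sp d → Sp d) (h k : Fin d) : ℝ :=
  ∫ s in Set.Ioi (0 : ℝ), ∫ y, u s y h * u s y k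

lemma tendsto_duhamelRhs (hd : 2 ≤ d) {C : ℝ} {a : Sp d → Sp d} {u : ℝ → Sp d → Sp d}
    (hu : MemCw 0 u) (hdec : HasDecay C u) (ha : Integrable a) (h0 : ∫ y, a y = 0)
    (h1 : Integrable fun y => (1 + ‖y‖) * ‖a y‖) (x : Sp d) :
    Tendsto (fun t => √t ^ (d + 1) • duhamelRhs a u t (√t • x)) atTop
      (𝓝 (profile a (totalEnergy u) x)) := by
  unfold duhamelRhs profile
  simp only [smul_sub]
  refine (tendsto_heat ha h0 h1 x).sub ?_
  simp only [← WithLp.toLp_smul]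
  refine ((PiLp.continuous_toLp 2 _).tendsto _).comp (tendsto_pi_nhds.2 fun j => ?_)
  simp only [Pi.smul_apply, smul_eq_mul, Finset.mul_sum]
  exact tendsto_finsetSum _ fun h _ => tendsto_finsetSum _ fun k _ =>
    tendsto_duhamel (isDecayingSource hu hdec h k) hd j h k x

lemma IsMildSolution.ae_eq_duhamelRhs {a : Sp d → Sp d} {u : ℝ → Sp d → Sp d}
    (hu : IsMildSolution a u) {t : ℝ} (ht : 0 < t) : ∀ᵐ z, u t z = duhamelRhs a u t z := by
  filter_upwards [hu.duhamel t ht] with z hz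
  ext j
  rw [hz j]; rfl

/-- The velocity is bounded in parabolic units. -/
lemma HasDecay.sqrt_pow_mul_le {C : ℝ} {u : ℝ → Sp d → Sp d} (h : HasDecay C u) {t : ℝ}
    (ht : 0 < t) : ∀ᵐ z, √t ^ (d + 1) * ‖u t z‖ ≤ C := by
  have hd0 : (0 : ℝ) ≤ d := Nat.cast_nonneg d
  filter_upwards [h.2 0 ((d : ℝ) + 1) le_rfl (by linarith) (by linarith) t ht.le] with z hz
  have h1 : √t ^ (d + 1) ≤ (1 + t) ^ (((d : ℝ) + 1) / 2) := by
    rw [Real.sqrt_eq_rpow, ← Real.rpow_natCast, ← Real.rpow_mul ht.le]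
    push_cast
    rw [show (1 / 2 : ℝ) * (d + 1) = ((d : ℝ) + 1) / 2 by ring]
    exact Real.rpow_le_rpow ht.le (by linarith) (by positivity)
  rw [neg_zero, Real.rpow_zero, mul_one, neg_div, Real.rpow_neg (by linarith)] at hz
  calc _ ≤ (1 + t) ^ (((d : ℝ) + 1) / 2) * (C * ((1 + t) ^ (((d : ℝ) + 1) / 2))⁻¹) := by gcongr
    _ = C := by
        have : (1 + t) ^ (((d : ℝ) + 1) / 2) ≠ 0 := (Real.rpow_pos_of_pos (by linarith) _).ne'
        field_simp

lemma aestronglyMeasurable_rescaled {f : Sp d → Sp d} (hf : AEStronglyMeasurable f volume) {t : ℝ}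
    (ht : 0 < t) : AEStronglyMeasurable (fun x => ‖√t ^ (d + 1) • f (√t • x)‖) volume := by
  have h1 : AEStronglyMeasurable (fun x => f (√t • x)) volume :=
    hf.comp_quasiMeasurePreserving
      (Measure.quasiMeasurePreserving_smul volume (Real.sqrt_pos.2 ht).ne')
  have h2 : AEStronglyMeasurable (fun x => √t ^ (d + 1) • f (√t • x)) volume :=
    h1.const_smul (√t ^ (d + 1))
  exact h2.norm

/-- If the profile is not identically zero, the rescaled velocity is bounded below in `L¹` of
some ball away from the origin. -/
lemma exists_ball_lower_bound (hd : 2 ≤ d) {C : ℝ} {a : Sp d → Sp d} {u : ℝ → Sp d → Sp d}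
    (hu : IsMildSolution a u) (hdec : HasDecay C u) (ha : Integrable a) (h0 : ∫ y, a y = 0)
    (h1 : Integrable fun y => (1 + ‖y‖) * ‖a y‖) {x₀ : Sp d}
    (hx₀ : profile a (totalEnergy u) x₀ ≠ 0) :
    ∃ (x₁ : Sp d) (ρ c t₀ : ℝ), 0 < ρ ∧ ρ < ‖x₁‖ ∧ 0 < c ∧ 0 < t₀ ∧ ∀ t, t₀ ≤ t →
      ENNReal.ofReal c ≤ ∫⁻ x in Metric.ball x₁ ρ, ‖√t ^ (d + 1) • u t (√t • x)‖ₑ := by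
  have : NeZero d := ⟨by omega⟩
  set U := profile a (totalEnergy u) with hU
  have hUc : Continuous U := continuous_profile ha h1 _
  have hopen : IsOpen {x | U x ≠ 0} := isOpen_ne_fun hUc continuous_const
  obtain ⟨x₁, hx₁, hx₁0⟩ := (dense_compl_singleton (0 : Sp d)).inter_open_nonempty _ hopen ⟨x₀, hx₀⟩
  have hnorm : 0 < ‖x₁‖ := norm_pos_iff.2 hx₁0
  obtain ⟨ε, hε, hball⟩ := Metric.isOpen_iff.1 hopen x₁ hx₁
  set ρ := min ε (‖x₁‖ / 2) with hρ
  have hρ0 : 0 < ρ := lt_min hε (by linarith)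
  have hpos : 0 < ∫ x in Metric.ball x₁ ρ, ‖U x‖ := by
    have hi : IntegrableOn (fun x => ‖U x‖) (Metric.ball x₁ ρ) :=
      (hUc.norm.continuousOn.integrableOn_compact (isCompact_closedBall x₁ ρ)).mono_set
        Metric.ball_subset_closedBall
    rw [setIntegral_pos_iff_support_of_nonneg_ae (ae_of_all _ fun x => norm_nonneg _) hi]
    refine (Metric.measure_ball_pos volume x₁ hρ0).trans_le (measure_mono fun x hx => ⟨?_, hx⟩)
    exact norm_ne_zero_iff.2 (hball (Metric.ball_subset_ball (min_le_left _ _) hx))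
  have hqmp : ∀ {t : ℝ}, 0 < t → Measure.QuasiMeasurePreserving (fun x : Sp d => √t • x)
      volume volume := fun ht =>
    Measure.quasiMeasurePreserving_smul volume (Real.sqrt_pos.2 ht).ne'
  have hae : ∀ {t : ℝ}, 0 < t → (fun x => ‖√t ^ (d + 1) • u t (√t • x)‖) =ᵐ[volume]
      fun x => ‖√t ^ (d + 1) • duhamelRhs a u t (√t • x)‖ := fun {t} ht => by
    filter_upwards [(hqmp ht).ae (hu.ae_eq_duhamelRhs ht)] with x hx
    rw [hx]
  have hlim : Tendsto (fun t => ∫ x in Metric.ball x₁ ρ, ‖√t ^ (d + 1) • duhamelRhs a u t (√t • x)‖)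
      atTop (𝓝 (∫ x in Metric.ball x₁ ρ, ‖U x‖)) := by
    refine tendsto_integral_filter_of_dominated_convergence (fun _ => C) ?_ ?_
      (integrableOn_const (measure_ball_lt_top.ne)) (ae_of_all _ fun x =>
        (tendsto_duhamelRhs hd hu.memCw hdec ha h0 h1 x).norm)
    · filter_upwards [eventually_gt_atTop 0] with t ht
      have h2 := aestronglyMeasurable_rescaled (hu.memCw.mem t ht.le).1 ht
      exact (h2.congr (hae ht)).restrict
    · filter_upwards [eventually_gt_atTop 0] with t ht
      refine ae_restrict_of_ae ?_
      filter_upwards [(hqmp ht).ae (hdec.sqrt_pow_mul_le ht), hae ht] with x hx hx'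
      rw [← hx', norm_norm, norm_smul, Real.norm_of_nonneg (by positivity)]
      exact hx
  obtain ⟨t₁, ht₁⟩ := eventually_atTop.1 (hlim.eventually (lt_mem_nhds (half_lt_self hpos)))
  refine ⟨x₁, ρ, _, max t₁ 1, hρ0, (min_le_right _ _).trans_lt (half_lt_self hnorm),
    half_pos hpos, lt_max_of_lt_right one_pos, fun t ht => ?_⟩
  have ht0 : 0 < t := one_pos.trans_le ((le_max_right _ _).trans ht)
  have h2 := ht₁ t ((le_max_left _ _).trans ht)
  rw [← integral_congr_ae (ae_restrict_of_ae (hae ht0))] at h2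
  refine (ENNReal.ofReal_le_ofReal h2.le).trans ?_
  have h3 := enorm_integral_le_lintegral_enorm (μ := volume.restrict (Metric.ball x₁ ρ))
    (fun x => ‖√t ^ (d + 1) • u t (√t • x)‖)
  rw [Real.enorm_of_nonneg (integral_nonneg fun _ => norm_nonneg _)] at h3
  simpa only [enorm_norm] using h3

lemma setLIntegral_ball_smul {T : ℝ} (hT : 0 < T) (x₁ : Sp d) (ρ : ℝ) (g : Sp d → ℝ≥0∞) :
    ∫⁻ z in Metric.ball (T • x₁) (T * ρ), g z =
      ENNReal.ofReal (T ^ d) * ∫⁻ x in Metric.ball x₁ ρ, g (T • x) := by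
  have hpre : (fun x : Sp d => T • x) ⁻¹' Metric.ball (T • x₁) (T * ρ) = Metric.ball x₁ ρ := by
    ext x
    simp [dist_smul₀, abs_of_pos hT, hT]
  have hmp : MeasurePreserving (fun x : Sp d => T • x) volume
      (ENNReal.ofReal (T ^ d)⁻¹ • volume) := by
    refine ⟨measurable_const_smul T, ?_⟩
    rw [Measure.map_addHaar_smul volume hT.ne', finrank_euclideanSpace_fin,
      abs_of_pos (by positivity)]
  have h1 := hmp.setLIntegral_comp_preimage_emb
    (Homeomorph.smulOfNeZero T hT.ne').measurableEmbedding g (Metric.ball (T • x₁) (T * ρ))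
  rw [hpre, Measure.restrict_smul, lintegral_smul_measure] at h1
  rw [h1, smul_eq_mul, ← mul_assoc, ← ENNReal.ofReal_mul (by positivity),
    mul_inv_cancel₀ (by positivity), ENNReal.ofReal_one, one_mul]

/-- Hölder's inequality on a set at distance `r` from the origin. It includes `p = ∞`, where
`1 / p.toReal = 0`. -/
lemma ofReal_mul_le_wNorm_mul {p : ℝ≥0∞} (hp : 1 ≤ p) {α : ℝ} (hα : 0 ≤ α) {f : Sp d → Sp d}
    (hf : AEStronglyMeasurable f volume) {S : Set (Sp d)} (hS : MeasurableSet S) {r : ℝ}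
    (hr : 0 ≤ r) (hSr : ∀ z ∈ S, r ≤ ‖z‖) :
    ENNReal.ofReal (r ^ α) * ∫⁻ z in S, ‖f z‖ₑ ≤
      wNorm p α f * volume S ^ (1 - 1 / p.toReal) := by
  have hw : AEStronglyMeasurable (fun x => (1 + ‖x‖) ^ α • f x) volume := by
    have : Continuous fun x : Sp d => (1 + ‖x‖) ^ α :=
      (continuous_const.add continuous_norm).rpow_const fun x => Or.inr hα
    exact this.aestronglyMeasurable.smul hf
  have h1 := eLpNorm_le_eLpNorm_mul_rpow_measure_univ (μ := volume.restrict S) hp hw.restrict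
  rw [Measure.restrict_apply_univ, ENNReal.toReal_one, div_one,
    eLpNorm_one_eq_lintegral_enorm] at h1
  refine le_trans ?_ (h1.trans (by
    gcongr
    exact eLpNorm_mono_measure _ Measure.restrict_le_self))
  rw [← lintegral_const_mul'' _ hf.restrict.enorm]
  refine setLIntegral_mono' hS fun z hz => ?_
  rw [enorm_smul, Real.enorm_of_nonneg (by positivity)]
  gcongr
  linarith [hSr z hz]

/-- A lower bound in `L¹` of a parabolically scaled ball yields lower bounds in all
weighted Lebesgue norms, by Hölder's inequality on that ball; the constant is uniform. -/
lemma wNorm_lower_bound {u : ℝ → Sp d → Sp d}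
    (hmeas : ∀ t, 0 ≤ t → AEStronglyMeasurable (u t) volume)
    {x₁ : Sp d} {ρ c t₀ : ℝ} (hρx : ρ < ‖x₁‖) (hc : 0 < c) (ht₀ : 0 < t₀)
    (hlow : ∀ t, t₀ ≤ t →
      ENNReal.ofReal c ≤ ∫⁻ x in Metric.ball x₁ ρ, ‖√t ^ (d + 1) • u t (√t • x)‖ₑ) :
    ∃ c', 0 < c' ∧ ∀ (p : ℝ≥0∞) (α : ℝ), 1 ≤ p → 0 ≤ α → α ≤ (d : ℝ) + 1 → ∀ t, t₀ ≤ t →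
      ENNReal.ofReal (c' * t ^ (-(1 / 2 : ℝ) * ((d : ℝ) + 1 - α - d * (1 / p.toReal)))) ≤
        wNorm p α (u t) := by
  -- `r ≤ 1` and `M ≥ 1` allow the powers `r ^ α` and `|B| ^ (1 - 1/p)` to be bounded uniformly.
  set r := min 1 (‖x₁‖ - ρ) with hr
  have hr0 : 0 < r := lt_min one_pos (sub_pos.2 hρx)
  set M := max 1 (volume (Metric.ball x₁ ρ)).toReal with hM
  have hM1 : 1 ≤ M := le_max_left _ _
  have hMv : volume (Metric.ball x₁ ρ) ≤ ENNReal.ofReal M := by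
    rw [← ENNReal.ofReal_toReal (measure_ball_lt_top (x := x₁) (r := ρ) (μ := volume)).ne]
    exact ENNReal.ofReal_le_ofReal (le_max_right _ _)
  refine ⟨c * r ^ ((d : ℝ) + 1) / M, by positivity, fun p α hp hα hαd t ht => ?_⟩
  have ht0 : 0 < t := ht₀.trans_le ht
  set T := √t with hT
  have hT0 : 0 < T := Real.sqrt_pos.2 ht0
  set q := 1 / p.toReal with hq
  have hq0 : 0 ≤ q := by positivity
  have hq1 : q ≤ 1 := by
    rcases eq_or_ne p ⊤ with rfl | hpt
    · simp [hq]
    · have : 1 ≤ p.toReal := by simpa using ENNReal.toReal_mono hpt hp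
      exact (div_le_one (by linarith)).2 this
  have hSr : ∀ z ∈ Metric.ball (T • x₁) (T * ρ), T * r ≤ ‖z‖ := fun z hz => by
    have h1 : ‖T • x₁‖ - ‖z‖ ≤ ‖T • x₁ - z‖ := norm_sub_norm_le _ _
    rw [Metric.mem_ball, dist_eq_norm, norm_sub_rev] at hz
    rw [norm_smul, Real.norm_of_nonneg hT0.le] at h1
    have h2 : T * r ≤ T * (‖x₁‖ - ρ) := mul_le_mul_of_nonneg_left (min_le_right _ _) hT0.le
    linarith
  have hH := ofReal_mul_le_wNorm_mul hp hα (hmeas t ht0.le) Metric.isOpen_ball.measurableSet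
    (by positivity) hSr
  rw [setLIntegral_ball_smul hT0] at hH
  have hX : ENNReal.ofReal (c / T ^ (d + 1)) ≤ ∫⁻ x in Metric.ball x₁ ρ, ‖u t (T • x)‖ₑ := by
    have h1 := hlow t ht
    simp only [enorm_smul] at h1
    rw [lintegral_const_mul' _ _ enorm_ne_top, Real.enorm_of_nonneg (by positivity)] at h1
    rw [ENNReal.ofReal_div_of_pos (by positivity)]
    exact ENNReal.div_le_of_le_mul' h1
  have hvol : volume (Metric.ball (T • x₁) (T * ρ)) ^ (1 - q) ≤
      ENNReal.ofReal (M * (T ^ d) ^ (1 - q)) := by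
    have h1 := setLIntegral_ball_smul hT0 x₁ ρ (fun _ => 1)
    rw [setLIntegral_one, setLIntegral_one] at h1
    rw [h1, ENNReal.mul_rpow_of_nonneg _ _ (by linarith), mul_comm,
      ENNReal.ofReal_mul (by linarith), ENNReal.ofReal_rpow_of_pos (by positivity)]
    gcongr
    refine (ENNReal.rpow_le_rpow hMv (by linarith)).trans ?_
    rw [ENNReal.ofReal_rpow_of_pos (by linarith)]
    exact ENNReal.ofReal_le_ofReal (Real.rpow_le_self_of_one_le hM1 (by linarith))
  have hfin : ENNReal.ofReal ((T * r) ^ α * (T ^ d * (c / T ^ (d + 1)))) ≤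
      wNorm p α (u t) * ENNReal.ofReal (M * (T ^ d) ^ (1 - q)) := by
    rw [ENNReal.ofReal_mul (by positivity), ENNReal.ofReal_mul (by positivity)]
    refine le_trans ?_ (hH.trans ?_)
    · gcongr
    · gcongr
  have hω : 0 < M * (T ^ d) ^ (1 - q) := by positivity
  refine le_trans (b := ENNReal.ofReal ((T * r) ^ α * (T ^ d * (c / T ^ (d + 1))) /
    (M * (T ^ d) ^ (1 - q)))) (ENNReal.ofReal_le_ofReal ?_) ?_
  · have hrα : r ^ ((d : ℝ) + 1) ≤ r ^ α :=
      Real.rpow_le_rpow_of_exponent_ge hr0 (min_le_left _ _) hαd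
    have ht' : t ^ (-(1 / 2 : ℝ) * ((d : ℝ) + 1 - α - d * q)) =
        T ^ α * (T ^ d * (T ^ (d + 1))⁻¹) * ((T ^ d) ^ (1 - q))⁻¹ := by
      have e : t = T ^ (2 : ℝ) := by rw [Real.rpow_two, Real.sq_sqrt ht0.le]
      rw [← Real.rpow_natCast, ← Real.rpow_natCast, ← Real.rpow_mul hT0.le, ← Real.rpow_neg hT0.le,
        ← Real.rpow_neg hT0.le, ← Real.rpow_add hT0, ← Real.rpow_add hT0, ← Real.rpow_add hT0, e,
        ← Real.rpow_mul hT0.le]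
      congr 1; push_cast; ring
    rw [ht', Real.mul_rpow hT0.le hr0.le]
    calc _ = r ^ ((d : ℝ) + 1) * (c / M * (T ^ α * (T ^ d * (T ^ (d + 1))⁻¹) *
          ((T ^ d) ^ (1 - q))⁻¹)) := by ring
      _ ≤ r ^ α * (c / M * (T ^ α * (T ^ d * (T ^ (d + 1))⁻¹) * ((T ^ d) ^ (1 - q))⁻¹)) := by
          gcongr
      _ = _ := by rw [div_eq_mul_inv, div_eq_mul_inv, div_eq_mul_inv, mul_inv]; ring
  · rw [ENNReal.ofReal_div_of_pos hω]
    exact ENNReal.div_le_of_le_mul hfin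

end LowerBound

end NavierStokes

theorem mainTheorem5 (d : ℕ) (hd : 2 ≤ d) (ϑ : ℝ) (hϑ : (d : ℝ) + 1 < ϑ)
    (a : NavierStokes.Sp d → NavierStokes.Sp d)
    (ha : NavierStokes.MemLinf ϑ a) (hdiv : NavierStokes.DivFree a)
    (u : ℝ → NavierStokes.Sp d → NavierStokes.Sp d)
    (hu : NavierStokes.IsMildSolution a u)
    (hdecay : NavierStokes.SpaceTimeDecay ϑ u) :
    (∀ x : NavierStokes.Sp d, x ≠ 0 →
      Tendsto (fun t : ℝ => gradient (NavierStokes.potential u t) x) atTop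
        (𝓝 (NavierStokes.gradPotentialInfty u x))) ∧
    ((∃ x : NavierStokes.Sp d, x ≠ 0 ∧ NavierStokes.gradPotentialInfty u x ≠ 0) →
      ∃ t₀ c : ℝ, 0 < t₀ ∧ 0 < c ∧
        (∀ p α : ℝ, 1 ≤ p → 0 ≤ α → α + (d : ℝ) / p < (d : ℝ) + 1 →
          ∀ t : ℝ, t₀ ≤ t →
            ENNReal.ofReal (c * t ^ (-(1 / 2 : ℝ) * ((d : ℝ) + 1 - α - (d : ℝ) / p))) ≤
              NavierStokes.wNorm (ENNReal.ofReal p) α (u t)) ∧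
        (∀ α : ℝ, 0 ≤ α → α ≤ (d : ℝ) + 1 →
          ∀ t : ℝ, t₀ ≤ t →
            ENNReal.ofReal (c * t ^ (-(1 / 2 : ℝ) * ((d : ℝ) + 1 - α))) ≤
              NavierStokes.wNorm ⊤ α (u t))) := by
  obtain ⟨C, hdec⟩ := hdecay.exists_hasDecay hϑ
  have hK : ∀ h k, Tendsto (NavierStokes.energyK u h k) atTop
      (𝓝 (NavierStokes.totalEnergy u h k)) := fun h k =>
    (NavierStokes.isDecayingSource hu.memCw hdec h k).tendsto_mass hd
  have hgrad : ∀ x : NavierStokes.Sp d, x ≠ 0 → NavierStokes.gradPotentialInfty u x = _ :=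
    fun x hx => (NavierStokes.tendsto_gradient_potential hd hK hx).limUnder_eq
  refine ⟨fun x hx => ?_, ?_⟩
  · rw [hgrad x hx]
    exact NavierStokes.tendsto_gradient_potential hd hK hx
  rintro ⟨x, hx, hne⟩
  have hnot : ¬ ∃ κ, ∀ h k, NavierStokes.totalEnergy u h k = κ * NavierStokes.kron h k := by
    rintro ⟨κ, hκ⟩
    refine hne ?_
    rw [hgrad x hx]
    simp only [hκ]
    rw [NavierStokes.sum_fderiv_basicPotential_eq_zero hd κ hx, smul_zero, map_zero]
  have hai := ha.integrable hϑ
  have ha1 := ha.integrable_moment hϑ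
  obtain ⟨x₀, hx₀⟩ := NavierStokes.exists_profile_ne_zero hai ha1 (fun h k => by
    simp only [NavierStokes.totalEnergy, mul_comm]) hnot
  obtain ⟨x₁, ρ, c, t₀, -, hρx, hc, ht₀, hlow⟩ := NavierStokes.exists_ball_lower_bound hd hu hdec
    hai (hdiv.integral_eq_zero hai) ha1 hx₀
  obtain ⟨c', hc', hb⟩ := NavierStokes.wNorm_lower_bound
    (fun t ht => (hu.memCw.mem t ht).1) hρx hc ht₀ hlow
  refine ⟨t₀, c', ht₀, hc', fun p α hp hα hαp t ht => ?_, fun α hα hαd t ht => ?_⟩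
  · have h1 : 0 ≤ (d : ℝ) / p := by positivity
    have := hb (ENNReal.ofReal p) α (by simpa using ENNReal.ofReal_le_ofReal hp) hα (by linarith)
      t ht
    rwa [ENNReal.toReal_ofReal (by linarith), mul_one_div] at this
  · simpa using hb ⊤ α le_top hα hαd t ht
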